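/- Let $X$ be a (nonempty) CAT$(0)$ space. A *flat* in $X$ is the image of an isometric embedding $\mathbb{E}^k \to X$ of a Euclidean space of dimension $k \ge 2$, and a *maximal flat* is a flat that is not properly contained in another flat. The space $X$ *has isolated flats* if there is a family $\mathcal{F}$ of flats in $X$ such that (1) there is $B \ge 0$ such that every flat in $X$ is contained in the $B$-neighbourhood of some member of $\mathcal{F}$, and (2) there is a function $\phi \colon \mathbb{R}_{\ge 0} \to \mathbb{R}_{\ge 0}$ such that for all distinct $E_1, E_2 \in \mathcal{F}$ and all $k \ge 0$ the intersection of the $k$-neighbourhoods of $E_1$ and $E_2$ has diameter less than $\phi(k)$. An action of a group $\Gamma$ by isometries on $X$ is *proper* if each point $x \in X$ has a ball $B(x,r)$, $r > 0$, with $gB(x,r) \cap B(x,r) \ne \emptyset$ for only finitely many $g \in \Gamma$; it is *cocompact* if $X = \Gamma K$ for some compact set $K \subseteq X$; and it is *toral* if for every maximal flat $E \subseteq X$ the stabiliser $\{g \in \Gamma : gE = E\}$ is free abelian. **Corollary 2.9.** Let $\Gamma$ be a torsion-free group which admits a proper, cocompact, toral action by isometries on some (nonempty) CAT$(0)$ space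 with isolated flats. Then $\Gamma$ is CSA: for every maximal abelian subgroup $A$ of $\Gamma$, $A$ is malnormal, i.e. $gAg^{-1} \cap A = \{1\}$ for all $g \in \Gamma \smallsetminus A$. -/

import Mathlib

open scoped Pointwise NNReal ENNReal

universe u v

/-- `c` restricted to `[0, l]` is a geodesic path from `p` to `q` (parametrised by arc length, so
that `l = dist p q`). The values of `c` outside `[0, l]` play no role. -/
structure IsGeodesicPath {X : Type v} [MetricSpace X] (c : ℝ → X) (l : ℝ) (p q : X) : Prop where
  length_nonneg : 0 ≤ l
  source : c 0 = p
  target : c l = q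
  dist_eq : ∀ s ∈ Set.Icc 0 l, ∀ t ∈ Set.Icc 0 l, dist (c s) (c t) = |s - t|

/-- A geodesic metric space: any two points are joined by a geodesic. -/
def IsGeodesicSpace (X : Type v) [MetricSpace X] : Prop :=
  ∀ p q : X, ∃ (c : ℝ → X) (l : ℝ), IsGeodesicPath c l p q

/-- A CAT(0) space: a geodesic metric space in which each geodesic triangle is at least as thin as
its comparison triangle in the Euclidean plane. Here `p' q' r'` is a comparison triangle for
`p q r`, the points `x ∈ [p, q]` and `y ∈ [p, r]` lie on two sides of the triangle, and `x' y'` are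
their comparison points. As the vertices are arbitrary, every pair of distinct sides is covered;
two points of the same side satisfy the inequality trivially. -/
structure IsCAT0 (X : Type v) [MetricSpace X] : Prop where
  geodesic : IsGeodesicSpace X
  comparison : ∀ (p q r : X) (c₁ c₂ : ℝ → X) (l₁ l₂ : ℝ),
    IsGeodesicPath c₁ l₁ p q → IsGeodesicPath c₂ l₂ p r →
    ∀ x ∈ c₁ '' Set.Icc 0 l₁, ∀ y ∈ c₂ '' Set.Icc 0 l₂,
    ∀ p' q' r' : EuclideanSpace ℝ (Fin 2),
      dist p' q' = dist p q → dist p' r' = dist p r → dist q' r' = dist q r →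
    ∀ x' ∈ segment ℝ p' q', ∀ y' ∈ segment ℝ p' r',
      dist p' x' = dist p x → dist p' y' = dist p y →
      dist x y ≤ dist x' y'

/-- A flat: the image of an isometric embedding of a Euclidean space of dimension at least two. -/
def IsFlat {X : Type v} [MetricSpace X] (E : Set X) : Prop :=
  ∃ k : ℕ, 2 ≤ k ∧ ∃ f : EuclideanSpace ℝ (Fin k) → X, Isometry f ∧ Set.range f = E

/-- A maximal flat: a flat that is not properly contained in another flat. -/
def IsMaximalFlat {X : Type v} [MetricSpace X] (E : Set X) : Prop :=
  Maximal IsFlat E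

/-- The isolated flats condition. The diameter is taken in `[0, ∞]`, so that the second condition
makes the intersections of neighbourhoods bounded. -/
def HasIsolatedFlats (X : Type v) [MetricSpace X] : Prop :=
  ∃ F : Set (Set X), (∀ E ∈ F, IsFlat E) ∧
    (∃ B : ℝ, 0 ≤ B ∧ ∀ E : Set X, IsFlat E → ∃ E' ∈ F, E ⊆ Metric.cthickening B E') ∧
    (∃ φ : ℝ≥0 → ℝ≥0, ∀ E₁ ∈ F, ∀ E₂ ∈ F, E₁ ≠ E₂ → ∀ k : ℝ≥0,
      Metric.ediam (Metric.cthickening (k : ℝ) E₁ ∩ Metric.cthickening (k : ℝ) E₂) < (φ k : ℝ≥0∞))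

/-- A proper action on a metric space: each point has a ball which meets only finitely many
of its translates. -/
def IsProperAction (Γ : Type u) [Group Γ] (X : Type v) [MetricSpace X] [MulAction Γ X] : Prop :=
  ∀ x : X, ∃ r : ℝ, 0 < r ∧ {g : Γ | (g • Metric.ball x r ∩ Metric.ball x r).Nonempty}.Finite

/-- A cocompact action: the translates of some compact set cover the space. -/
def IsCocompactAction (Γ : Type u) [Group Γ] (X : Type v) [MetricSpace X] [MulAction Γ X] : Prop :=
  ∃ K : Set X, IsCompact K ∧ ⋃ g : Γ, g • K = Set.univ

/-- A free abelian group (of any rank). -/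
def IsFreeAbelian (G : Type u) [Group G] : Prop :=
  ∃ ι : Type u, Nonempty (G ≃* Multiplicative (FreeAbelianGroup ι))

/-- A toral action: the (setwise) stabiliser of each maximal flat is free abelian. -/
def IsToralAction (Γ : Type u) [Group Γ] (X : Type v) [MetricSpace X] [MulAction Γ X] : Prop :=
  ∀ E : Set X, IsMaximalFlat E → IsFreeAbelian (MulAction.stabilizer Γ E)

/-- A toral CAT(0) group with isolated flats: a group with a proper, cocompact, toral action by
isometries on some (nonempty) CAT(0) space with isolated flats. -/
def IsToralCAT0GroupWithIsolatedFlats (Γ : Type u) [Group Γ] : Prop :=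
  ∃ (X : Type v) (_ : MetricSpace X) (_ : MulAction Γ X),
    Nonempty X ∧ IsCAT0 X ∧ HasIsolatedFlats X ∧ IsIsometricSMul Γ X ∧
      IsProperAction Γ X ∧ IsCocompactAction Γ X ∧ IsToralAction Γ X

/-- A torsion-free group: no nontrivial element has finite order. (For noncommutative groups
`IsMulTorsionFree` is the stronger property that roots are unique.) -/
def IsTorsionFreeGroup (G : Type u) [Group G] : Prop :=
  ∀ g : G, g ≠ 1 → ¬ IsOfFinOrder g

/-- A malnormal subgroup: `g K g⁻¹ ∩ K = 1` for all `g ∉ K`. -/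
def IsMalnormal {G : Type u} [Group G] (K : Subgroup G) : Prop :=
  ∀ g : G, g ∉ K → K.map (MulAut.conj g).toMonoidHom ⊓ K = ⊥

/-- A maximal abelian subgroup: maximal among the abelian subgroups. -/
def IsMaximalAbelian {G : Type u} [Group G] (A : Subgroup G) : Prop :=
  Maximal (fun H : Subgroup G => ∀ x ∈ H, ∀ y ∈ H, x * y = y * x) A

/-- A CSA group: each maximal abelian subgroup is malnormal. -/
def IsCSA (G : Type u) [Group G] : Prop :=
  ∀ A : Subgroup G, IsMaximalAbelian A → IsMalnormal A

/-! Cocompactness makes each nontrivial `a` attain its minimal displacement, which is positive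
because `Γ` is torsion-free and the action proper; so `a` translates an axis. Elements commuting
with `a` carry this axis to parallel lines. If these lie arbitrarily far away, ever wider flat
strips, recentred by cocompactness, converge to a plane stabilised by a conjugate of `a`, so `a`
stabilises a flat. Otherwise finitely many cosets of `⟨a⟩` cover the centraliser of `a`
(`IsProperAction.exists_isFlat_or_finite`).

In the first case the flat lies near a member `E` of the isolated family. The flats parallel to `E`
have a unique circumcentre `C`, a maximal flat, so its stabiliser `P` is abelian by torality. It is
malnormal: if `b ≠ 1` and `g * b * g⁻¹` both lie in `P`, the latter has unbounded orbits near both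
`E` and `g • E`, so isolation makes these parallel and `g` fixes `C`
(`exists_malnormal_of_smul_isFlat_eq`). In the second case the centraliser has finitely many
commutators, hence is abelian by Schur's theorem and torsion-freeness.

Thus commutation is transitive on nontrivial elements, and a maximal abelian `A` is the centraliser
of each of its nontrivial elements. Let `a ≠ 1` and `g * a * g⁻¹` lie in `A`. In the first case `g`
lies in the abelian group `P` containing `a`. In the second, `g` conjugates some `a ^ n`, `n ≠ 0`,
to `a ^ m`; displacement growth gives `m = ±n`, so `g ^ 2` commutes with `a ^ n`. Either way `g ∈
A`. -/

section Euclidean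

/-! ### Euclidean comparison triangles. -/

variable {V : Type*} [NormedAddCommGroup V] [InnerProductSpace ℝ V]

/-- Stewart's theorem, the Euclidean equality behind the Bruhat–Tits inequality. -/
theorem dist_lineMap_sq (p q r : V) (t : ℝ) :
    dist (AffineMap.lineMap p q t : V) r ^ 2 =
      (1 - t) * dist p r ^ 2 + t * dist q r ^ 2 - t * (1 - t) * dist p q ^ 2 := by
  have h1 : (AffineMap.lineMap p q t : V) - r = (1 - t) • (p - r) + t • (q - r) := by
    rw [AffineMap.lineMap_apply_module]; module
  have h2 : p - q = (p - r) - (q - r) := by abel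
  rw [dist_eq_norm, dist_eq_norm p r, dist_eq_norm q r, dist_eq_norm p q, h1, h2, norm_add_sq_real,
    norm_sub_sq_real (p - r) (q - r), norm_smul, norm_smul, real_inner_smul_left,
    real_inner_smul_right, mul_pow, mul_pow, Real.norm_eq_abs, Real.norm_eq_abs, sq_abs, sq_abs]
  ring

/-- Triples of distances satisfying the triangle inequalities are realised in the plane. -/
theorem exists_comparison_triangle {X : Type*} [MetricSpace X] (p q r : X) :
    ∃ p' q' r' : EuclideanSpace ℝ (Fin 2),
      dist p' q' = dist p q ∧ dist p' r' = dist p r ∧ dist q' r' = dist q r := by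
  rcases eq_or_ne p q with rfl | hpq
  · refine ⟨0, 0, !₂[dist p r, 0], by simp, ?_, ?_⟩ <;>
      simp [EuclideanSpace.dist_eq, Fin.sum_univ_two]
  have ha : 0 < dist p q := dist_pos.2 hpq
  set a := dist p q with ha'
  set b := dist p r with hb'
  set c := dist q r with hc'
  have h1 : a ≤ b + c := by rw [ha', hb', hc', dist_comm q r]; exact dist_triangle p r q
  have h2 : b ≤ a + c := dist_triangle p q r
  have h3 : c ≤ a + b := by rw [ha', hb', hc', dist_comm p q]; exact dist_triangle q p r
  have hb : 0 ≤ b := dist_nonneg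
  have hc : 0 ≤ c := dist_nonneg
  -- By the law of cosines, `x` is the coordinate of the third vertex along the side of length `a`.
  obtain ⟨x, hx⟩ : ∃ x, 2 * a * x = a ^ 2 + b ^ 2 - c ^ 2 :=
    ⟨(a ^ 2 + b ^ 2 - c ^ 2) / (2 * a), by field_simp⟩
  have hxb : x ^ 2 ≤ b ^ 2 := by
    apply sq_le_sq'
    · have : 0 ≤ a * (x + b) := by
        have : 0 ≤ (a + b - c) * (a + b + c) := mul_nonneg (by linarith) (by linarith)
        nlinarith
      have := nonneg_of_mul_nonneg_right this ha
      linarith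
    · have : 0 ≤ a * (b - x) := by
        have : 0 ≤ (c - (a - b)) * (c + (a - b)) := mul_nonneg (by linarith) (by linarith)
        nlinarith
      have := nonneg_of_mul_nonneg_right this ha
      linarith
  have hs : Real.sqrt (b ^ 2 - x ^ 2) ^ 2 = b ^ 2 - x ^ 2 := Real.sq_sqrt (by linarith)
  refine ⟨0, !₂[a, 0], !₂[x, Real.sqrt (b ^ 2 - x ^ 2)], ?_, ?_, ?_⟩
  · simp [EuclideanSpace.dist_eq, Fin.sum_univ_two, Real.sqrt_sq ha.le]
  · simp only [EuclideanSpace.dist_eq, Fin.sum_univ_two, Real.dist_eq]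
    simp only [PiLp.zero_apply, zero_sub, abs_neg, sq_abs, Matrix.cons_val_zero,
      Matrix.cons_val_one, hs]
    rw [Real.sqrt_eq_iff_mul_self_eq] <;> nlinarith
  · simp only [EuclideanSpace.dist_eq, Fin.sum_univ_two, Real.dist_eq]
    simp only [zero_sub, abs_neg, sq_abs, Matrix.cons_val_zero,
      Matrix.cons_val_one, hs]
    rw [Real.sqrt_eq_iff_mul_self_eq] <;> nlinarith

end Euclidean

/-! ### Geodesics, convexity and projections in CAT(0) spaces. -/

namespace IsCAT0

variable {X : Type v} [MetricSpace X] (hX : IsCAT0 X)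

/-- The point at parameter `t ∈ [0, 1]` on a geodesic from `p` to `q`. -/
noncomputable def geo (p q : X) (t : ℝ) : X :=
  (hX.geodesic p q).choose (t * dist p q)

theorem exists_isGeodesicPath (p q : X) :
    IsGeodesicPath (hX.geodesic p q).choose (dist p q) p q := by
  obtain ⟨l, hl⟩ := (hX.geodesic p q).choose_spec
  have := hl.dist_eq 0 ⟨le_rfl, hl.length_nonneg⟩ l ⟨hl.length_nonneg, le_rfl⟩
  rw [hl.source, hl.target, zero_sub, abs_neg, abs_of_nonneg hl.length_nonneg] at this
  rwa [← this] at hl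

theorem _root_.mul_dist_mem_Icc {p q : X} {t : ℝ} (ht : t ∈ Set.Icc (0 : ℝ) 1) :
    t * dist p q ∈ Set.Icc 0 (dist p q) :=
  ⟨mul_nonneg ht.1 dist_nonneg, mul_le_of_le_one_left dist_nonneg ht.2⟩

theorem geo_zero (p q : X) : hX.geo p q 0 = p := by
  rw [geo, zero_mul, (hX.exists_isGeodesicPath p q).source]

theorem geo_one (p q : X) : hX.geo p q 1 = q := by
  rw [geo, one_mul, (hX.exists_isGeodesicPath p q).target]

theorem dist_geo_geo (p q : X) {s t : ℝ} (hs : s ∈ Set.Icc (0 : ℝ) 1)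
    (ht : t ∈ Set.Icc (0 : ℝ) 1) :
    dist (hX.geo p q s) (hX.geo p q t) = |s - t| * dist p q := by
  rw [geo, geo, (hX.exists_isGeodesicPath p q).dist_eq _ (mul_dist_mem_Icc hs) _
    (mul_dist_mem_Icc ht), ← sub_mul, abs_mul, abs_of_nonneg (dist_nonneg (x := p))]

theorem dist_left_geo (p q : X) {t : ℝ} (ht : t ∈ Set.Icc (0 : ℝ) 1) :
    dist p (hX.geo p q t) = t * dist p q := by
  have := hX.dist_geo_geo p q (s := 0) (by simp) ht
  rwa [geo_zero, zero_sub, abs_neg, abs_of_nonneg ht.1] at this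

theorem dist_geo_right (p q : X) {t : ℝ} (ht : t ∈ Set.Icc (0 : ℝ) 1) :
    dist (hX.geo p q t) q = (1 - t) * dist p q := by
  have := hX.dist_geo_geo p q ht (t := 1) (by simp)
  rwa [geo_one, abs_sub_comm, abs_of_nonneg (sub_nonneg.2 ht.2)] at this

theorem dist_geo_geo_le_lineMap (p q r : X) {s t : ℝ} (hs : s ∈ Set.Icc (0 : ℝ) 1)
    (ht : t ∈ Set.Icc (0 : ℝ) 1) {p' q' r' : EuclideanSpace ℝ (Fin 2)}
    (h₁ : dist p' q' = dist p q) (h₂ : dist p' r' = dist p r) (h₃ : dist q' r' = dist q r) :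
    dist (hX.geo p q s) (hX.geo p r t) ≤
      dist (AffineMap.lineMap p' q' s : EuclideanSpace ℝ (Fin 2)) (AffineMap.lineMap p' r' t) := by
  refine hX.comparison p q r _ _ _ _ (hX.exists_isGeodesicPath p q)
    (hX.exists_isGeodesicPath p r) _ ⟨_, mul_dist_mem_Icc hs, rfl⟩ _
    ⟨_, mul_dist_mem_Icc ht, rfl⟩ p' q' r' h₁ h₂ h₃ _ ?_ _ ?_ ?_ ?_
  · rw [segment_eq_image_lineMap]; exact ⟨s, hs, rfl⟩
  · rw [segment_eq_image_lineMap]; exact ⟨t, ht, rfl⟩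
  · have := hX.dist_left_geo p q hs
    rw [geo] at this
    rw [this, dist_left_lineMap, h₁, Real.norm_of_nonneg hs.1]
  · have := hX.dist_left_geo p r ht
    rw [geo] at this
    rw [this, dist_left_lineMap, h₂, Real.norm_of_nonneg ht.1]

/-- The weighted inequality of Bruhat and Tits. -/
theorem dist_geo_sq_le (p q z : X) {t : ℝ} (ht : t ∈ Set.Icc (0 : ℝ) 1) :
    dist (hX.geo p q t) z ^ 2 ≤
      (1 - t) * dist p z ^ 2 + t * dist q z ^ 2 - t * (1 - t) * dist p q ^ 2 := by
  obtain ⟨p', q', r', h₁, h₂, h₃⟩ := exists_comparison_triangle p q z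
  have := hX.dist_geo_geo_le_lineMap p q z ht (t := 1) (by simp) h₁ h₂ h₃
  rw [geo_one, AffineMap.lineMap_apply_one] at this
  rw [← h₁, ← h₂, ← h₃, ← dist_lineMap_sq]
  exact pow_le_pow_left₀ dist_nonneg this 2

/-- With these two distances the right side of the Bruhat–Tits inequality vanishes. This uniqueness
makes isometries and isometric embeddings commute with `geo`. -/
theorem eq_geo {p q z : X} {t : ℝ} (ht : t ∈ Set.Icc (0 : ℝ) 1)
    (h₁ : dist p z = t * dist p q) (h₂ : dist z q = (1 - t) * dist p q) :
    z = hX.geo p q t := by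
  have := hX.dist_geo_sq_le p q z ht
  rw [h₁, dist_comm q z, h₂] at this
  have h0 : dist (hX.geo p q t) z ^ 2 ≤ 0 := by nlinarith
  have h1 : dist (hX.geo p q t) z = 0 := by
    have := sq_nonneg (dist (hX.geo p q t) z)
    exact pow_eq_zero_iff (two_ne_zero) |>.1 (le_antisymm h0 this)
  exact (dist_eq_zero.1 h1).symm

theorem eq_geo_of_le {p q z : X} {t : ℝ} (ht : t ∈ Set.Icc (0 : ℝ) 1)
    (h₁ : dist p z ≤ t * dist p q) (h₂ : dist z q ≤ (1 - t) * dist p q) :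
    z = hX.geo p q t := by
  have := dist_triangle p z q
  exact hX.eq_geo ht (by linarith) (by linarith)

theorem geo_symm (p q : X) {t : ℝ} (ht : t ∈ Set.Icc (0 : ℝ) 1) :
    hX.geo p q t = hX.geo q p (1 - t) := by
  apply hX.eq_geo ⟨by linarith [ht.2], by linarith [ht.1]⟩
  · rw [dist_comm q, hX.dist_geo_right p q ht, dist_comm p q]
  · rw [dist_comm _ p, hX.dist_left_geo p q ht, dist_comm p q]; ring

theorem dist_geo_geo_same_left_le (p q r : X) {t : ℝ} (ht : t ∈ Set.Icc (0 : ℝ) 1) :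
    dist (hX.geo p q t) (hX.geo p r t) ≤ t * dist q r := by
  obtain ⟨p', q', r', h₁, h₂, h₃⟩ := exists_comparison_triangle p q r
  refine (hX.dist_geo_geo_le_lineMap p q r ht ht h₁ h₂ h₃).trans_eq ?_
  rw [← h₃, AffineMap.lineMap_apply_module, AffineMap.lineMap_apply_module, dist_add_left,
    dist_smul₀, Real.norm_of_nonneg ht.1]

/-- The distance function of a CAT(0) space is convex. -/
theorem dist_geo_geo_le (a b c d : X) {t : ℝ} (ht : t ∈ Set.Icc (0 : ℝ) 1) :
    dist (hX.geo a b t) (hX.geo c d t) ≤ (1 - t) * dist a c + t * dist b d := by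
  -- The diagonal from `a` to `d` splits the quadrilateral into two triangles.
  have h1 := hX.dist_geo_geo_same_left_le a b d ht
  have h2 := hX.dist_geo_geo_same_left_le d a c (t := 1 - t)
    ⟨by linarith [ht.2], by linarith [ht.1]⟩
  rw [← hX.geo_symm a d ht, ← hX.geo_symm c d ht] at h2
  linarith [dist_triangle (hX.geo a b t) (hX.geo a d t) (hX.geo c d t)]

/-- Sum of squares of the diagonals of a quadrilateral. -/
theorem dist_sq_add_dist_sq_le (hX : IsCAT0 X) (a b c d : X) :
    dist a c ^ 2 + dist b d ^ 2 ≤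
      dist a b ^ 2 + dist b c ^ 2 + dist c d ^ 2 + dist d a ^ 2 := by
  have ht : (1 / 2 : ℝ) ∈ Set.Icc (0 : ℝ) 1 := by norm_num
  -- With `m` the midpoint of `a` and `c`, `dist b d ^ 2` is at most twice the sum of the squared
  -- distances from `m` to `b` and `d`.
  have h1 := hX.dist_geo_sq_le a c b ht
  have h2 := hX.dist_geo_sq_le a c d ht
  have h3 := dist_triangle_left b d (hX.geo a c (1 / 2))
  have h4 : dist b d ^ 2 ≤ (dist (hX.geo a c (1 / 2)) b + dist (hX.geo a c (1 / 2)) d) ^ 2 :=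
    pow_le_pow_left₀ dist_nonneg h3 2
  have h5 := sq_nonneg (dist (hX.geo a c (1 / 2)) b - dist (hX.geo a c (1 / 2)) d)
  rw [dist_comm b c, dist_comm d a]
  nlinarith

theorem smul_geo {G : Type*} [Group G] [MulAction G X] [IsIsometricSMul G X] (g : G)
    (p q : X) {t : ℝ} (ht : t ∈ Set.Icc (0 : ℝ) 1) :
    g • hX.geo p q t = hX.geo (g • p) (g • q) t := by
  apply hX.eq_geo ht
  · rw [dist_smul, dist_smul, hX.dist_left_geo p q ht]
  · rw [dist_smul, dist_smul, hX.dist_geo_right p q ht]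

theorem map_lineMap {V : Type*} [NormedAddCommGroup V] [NormedSpace ℝ V] {f : V → X}
    (hf : Isometry f) (x y : V) {t : ℝ} (ht : t ∈ Set.Icc (0 : ℝ) 1) :
    f (AffineMap.lineMap x y t) = hX.geo (f x) (f y) t := by
  apply hX.eq_geo ht
  · rw [hf.dist_eq, hf.dist_eq, dist_left_lineMap, Real.norm_of_nonneg ht.1]
  · rw [hf.dist_eq, hf.dist_eq, dist_lineMap_right, Real.norm_of_nonneg (sub_nonneg.2 ht.2)]

/-- A subset containing the geodesics between its points. -/
def GeoConvex (C : Set X) : Prop :=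
  ∀ x ∈ C, ∀ y ∈ C, ∀ t ∈ Set.Icc (0 : ℝ) 1, hX.geo x y t ∈ C

theorem geoConvex_range {V : Type*} [NormedAddCommGroup V] [NormedSpace ℝ V] {f : V → X}
    (hf : Isometry f) : hX.GeoConvex (Set.range f) := by
  rintro _ ⟨x, rfl⟩ _ ⟨y, rfl⟩ t ht
  exact ⟨_, hX.map_lineMap hf x y ht⟩

theorem infDist_geo_le {C : Set X} (hC : hX.GeoConvex C) (hne : C.Nonempty) (x y : X) {t : ℝ}
    (ht : t ∈ Set.Icc (0 : ℝ) 1) :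
    Metric.infDist (hX.geo x y t) C ≤ (1 - t) * Metric.infDist x C + t * Metric.infDist y C := by
  refine le_of_forall_pos_le_add fun ε hε => ?_
  obtain ⟨x', hx', hxx'⟩ := (Metric.infDist_lt_iff hne).1 (lt_add_of_pos_right
    (Metric.infDist x C) hε)
  obtain ⟨y', hy', hyy'⟩ := (Metric.infDist_lt_iff hne).1 (lt_add_of_pos_right
    (Metric.infDist y C) hε)
  have h1 := Metric.infDist_le_dist_of_mem (x := hX.geo x y t) (hC x' hx' y' hy' t ht)
  have h2 := hX.dist_geo_geo_le x y x' y' ht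
  have h3 := mul_le_mul_of_nonneg_left hxx'.le (sub_nonneg.2 ht.2)
  have h4 := mul_le_mul_of_nonneg_left hyy'.le ht.1
  linarith

/-- If `p` is a nearest point of `C` to `x`, then the angle at `p` is at least a right angle. -/
theorem dist_sq_add_dist_sq_le_of_nearest {C : Set X} (hC : hX.GeoConvex C) {x p q : X}
    (hp : p ∈ C) (hq : q ∈ C) (h : dist x p ≤ Metric.infDist x C) :
    dist x p ^ 2 + dist p q ^ 2 ≤ dist x q ^ 2 := by
  -- Points of `C` on the geodesic from `p` to `q` are no closer to `x` than `p`; divide the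
  -- resulting inequality by `t`, then let `t` tend to 0.
  have key : ∀ t ∈ Set.Ioc (0 : ℝ) 1,
      dist x p ^ 2 + (1 - t) * dist p q ^ 2 ≤ dist x q ^ 2 := by
    intro t ht
    have ht' : t ∈ Set.Icc (0 : ℝ) 1 := ⟨ht.1.le, ht.2⟩
    have h1 := hX.dist_geo_sq_le p q x ht'
    have h2 := h.trans (Metric.infDist_le_dist_of_mem (hC p hp q hq t ht'))
    have h3 : dist x p ^ 2 ≤ dist x (hX.geo p q t) ^ 2 := pow_le_pow_left₀ dist_nonneg h2 2
    rw [dist_comm _ x, dist_comm p x, dist_comm q x] at h1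
    have h4 : 0 ≤ t * (dist x q ^ 2 - (dist x p ^ 2 + (1 - t) * dist p q ^ 2)) := by nlinarith
    linarith [nonneg_of_mul_nonneg_right h4 ht.1]
  have hlim : Filter.Tendsto (fun t : ℝ => dist x p ^ 2 + (1 - t) * dist p q ^ 2)
      (nhdsWithin 0 (Set.Ioi 0)) (nhds (dist x p ^ 2 + (1 - 0) * dist p q ^ 2)) :=
    (Continuous.tendsto (by fun_prop) 0).mono_left nhdsWithin_le_nhds
  rw [sub_zero, one_mul] at hlim
  refine le_of_tendsto hlim ?_
  filter_upwards [Ioc_mem_nhdsGT (zero_lt_one' ℝ)] with t ht using key t ht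

theorem nearest_unique {C : Set X} (hC : hX.GeoConvex C) {x p q : X} (hp : p ∈ C) (hq : q ∈ C)
    (h : dist x p ≤ Metric.infDist x C) (h' : dist x q ≤ dist x p) : p = q := by
  have h1 := hX.dist_sq_add_dist_sq_le_of_nearest hC hp hq h
  have h2 := pow_le_pow_left₀ dist_nonneg h' 2
  have h3 : dist p q ^ 2 = 0 := le_antisymm (by linarith) (sq_nonneg _)
  exact dist_eq_zero.1 (pow_eq_zero_iff two_ne_zero |>.1 h3)

/-- The nearest point projection to a convex set does not increase distances. -/
theorem dist_nearest_le {C : Set X} (hC : hX.GeoConvex C) {x y p q : X} (hp : p ∈ C) (hq : q ∈ C)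
    (hxp : dist x p ≤ Metric.infDist x C) (hyq : dist y q ≤ Metric.infDist y C) :
    dist p q ≤ dist x y := by
  -- The right-angle inequalities at `p` and `q` bound the diagonals of `x y q p` from below; the
  -- quadrilateral inequality bounds them from above.
  have h1 := hX.dist_sq_add_dist_sq_le_of_nearest hC hp hq hxp
  have h2 := hX.dist_sq_add_dist_sq_le_of_nearest hC hq hp hyq
  have h3 := hX.dist_sq_add_dist_sq_le x y q p
  rw [dist_comm q p, dist_comm p x] at h3
  rw [dist_comm q p] at h2
  exact le_of_sq_le_sq (by nlinarith) dist_nonneg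

end IsCAT0

open Classical in
/-- A nearest point of `C` to `x`, if there is one. -/
noncomputable def nearestPoint {X : Type v} [MetricSpace X] (C : Set X) (x : X) : X :=
  if h : ∃ y ∈ C, Metric.infDist x C = dist x y then h.choose else x

section Nearest

variable {X : Type v} [MetricSpace X] [ProperSpace X] {C : Set X}

theorem nearestPoint_mem (hC : IsClosed C) (hne : C.Nonempty) (x : X) : nearestPoint C x ∈ C := by
  have h := hC.exists_infDist_eq_dist hne x
  rw [nearestPoint, dif_pos h]
  exact h.choose_spec.1

theorem dist_nearestPoint (hC : IsClosed C) (hne : C.Nonempty) (x : X) :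
    dist x (nearestPoint C x) = Metric.infDist x C := by
  have h := hC.exists_infDist_eq_dist hne x
  rw [nearestPoint, dif_pos h]
  exact h.choose_spec.2.symm

end Nearest

theorem Metric.infDist_le_dist_add {X : Type v} [MetricSpace X] (C : Set X) (x y : X) :
    Metric.infDist x C ≤ dist x y + Metric.infDist y C := by
  rw [add_comm]; exact Metric.infDist_le_infDist_add_dist

/-! ### Parallel convex sets and flat strips. -/

namespace IsCAT0

variable {X : Type v} [MetricSpace X] (hX : IsCAT0 X)

/-- Two closed convex sets at constant distance `D` from each other. -/
structure AreParallel (F G : Set X) (D : ℝ) : Prop where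
  isClosed_left : IsClosed F
  isClosed_right : IsClosed G
  convex_left : hX.GeoConvex F
  convex_right : hX.GeoConvex G
  nonempty_left : F.Nonempty
  nonempty_right : G.Nonempty
  infDist_left : ∀ x ∈ F, Metric.infDist x G = D
  infDist_right : ∀ y ∈ G, Metric.infDist y F = D

/-- The point at parameter `t` on the geodesic from `x` to its projection to `G`. -/
noncomputable def strip (G : Set X) (t : ℝ) (x : X) : X := hX.geo x (nearestPoint G x) t

/-- The parallel set at parameter `t` between two parallel sets. -/
def between (F G : Set X) (D t : ℝ) : Set X :=
  {z | Metric.infDist z F ≤ t * D ∧ Metric.infDist z G ≤ (1 - t) * D}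

namespace AreParallel

variable {hX} {F G : Set X} {D : ℝ}

theorem symm (h : hX.AreParallel F G D) : hX.AreParallel G F D :=
  ⟨h.2, h.1, h.4, h.3, h.6, h.5, h.8, h.7⟩

theorem nonneg (h : hX.AreParallel F G D) : 0 ≤ D := by
  obtain ⟨x, hx⟩ := h.nonempty_left
  rw [← h.infDist_left x hx]; exact Metric.infDist_nonneg

theorem le_dist (h : hX.AreParallel F G D) {x y : X} (hx : x ∈ F) (hy : y ∈ G) : D ≤ dist x y := by
  rw [← h.infDist_left x hx]; exact Metric.infDist_le_dist_of_mem hy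

theorem geoConvex_between (h : hX.AreParallel F G D) (t : ℝ) :
    hX.GeoConvex (between F G D t) := by
  intro x hx y hy s hs
  constructor
  · refine (hX.infDist_geo_le h.convex_left h.nonempty_left x y hs).trans ?_
    nlinarith [mul_le_mul_of_nonneg_left hx.1 (sub_nonneg.2 hs.2),
      mul_le_mul_of_nonneg_left hy.1 hs.1]
  · refine (hX.infDist_geo_le h.convex_right h.nonempty_right x y hs).trans ?_
    nlinarith [mul_le_mul_of_nonneg_left hx.2 (sub_nonneg.2 hs.2),
      mul_le_mul_of_nonneg_left hy.2 hs.1]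

/-- The geodesics between points of two parallel sets traverse the parallel sets in between. -/
theorem geo_mem_between (h : hX.AreParallel F G D) {x y : X} (hx : x ∈ F) (hy : y ∈ G) {t : ℝ}
    (ht : t ∈ Set.Icc (0 : ℝ) 1) : hX.geo x y t ∈ between F G D t := by
  constructor
  · refine (hX.infDist_geo_le h.convex_left h.nonempty_left x y ht).trans ?_
    rw [Metric.infDist_zero_of_mem hx, h.infDist_right y hy]; linarith
  · refine (hX.infDist_geo_le h.convex_right h.nonempty_right x y ht).trans ?_
    rw [Metric.infDist_zero_of_mem hy, h.infDist_left x hx]; linarith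

variable [ProperSpace X]

theorem dist_right (h : hX.AreParallel F G D) {x : X} (hx : x ∈ F) :
    dist x (nearestPoint G x) = D := by
  rw [dist_nearestPoint h.isClosed_right h.nonempty_right, h.infDist_left x hx]

theorem nearest_mem (h : hX.AreParallel F G D) (x : X) : nearestPoint G x ∈ G :=
  nearestPoint_mem h.isClosed_right h.nonempty_right x

theorem eq_nearestPoint (h : hX.AreParallel F G D) {x y : X} (hx : x ∈ F) (hy : y ∈ G)
    (hxy : dist x y ≤ D) : y = nearestPoint G x :=
  (hX.nearest_unique h.convex_right (h.nearest_mem x) hy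
    (dist_nearestPoint h.isClosed_right h.nonempty_right x).le
    (hxy.trans_eq (h.dist_right hx).symm)).symm

theorem strip_mem_between (h : hX.AreParallel F G D) {x : X} (hx : x ∈ F) {t : ℝ}
    (ht : t ∈ Set.Icc (0 : ℝ) 1) : hX.strip G t x ∈ between F G D t :=
  h.geo_mem_between hx (h.nearest_mem x) ht

/-- The distances from `z` to `F` and `G` add up to at most `D`, the least possible distance between
their points, so `z` is on the geodesic joining its two projections. -/
theorem exists_strip_eq (h : hX.AreParallel F G D) {t : ℝ} (ht : t ∈ Set.Icc (0 : ℝ) 1) {z : X}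
    (hz : z ∈ between F G D t) : ∃ x ∈ F, hX.strip G t x = z := by
  have hx := nearestPoint_mem h.isClosed_left h.nonempty_left z
  have hy := nearestPoint_mem h.isClosed_right h.nonempty_right z
  have hdx := dist_nearestPoint h.isClosed_left h.nonempty_left z
  have hdy := dist_nearestPoint h.isClosed_right h.nonempty_right z
  set x := nearestPoint F z
  set y := nearestPoint G z
  have h1 := dist_triangle_left x y z
  have h2 := h.le_dist hx hy
  have h3 := hz.1
  have h4 := hz.2
  have h5 : dist x y = D := le_antisymm (by linarith) h2
  have h6 : y = nearestPoint G x := h.eq_nearestPoint hx hy h5.le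
  refine ⟨x, hx, ?_⟩
  rw [strip, ← h6]
  symm
  apply hX.eq_geo_of_le ht
  · rw [h5, dist_comm, hdx]; exact h3
  · rw [h5, hdy]; exact h4

theorem dist_strip_strip_le (h : hX.AreParallel F G D) {x y : X} (hx : x ∈ F) (hy : y ∈ F) {t : ℝ}
    (ht : t ∈ Set.Icc (0 : ℝ) 1) : dist (hX.strip G t x) (hX.strip G t y) ≤ dist x y := by
  have h1 := hX.dist_geo_geo_le x (nearestPoint G x) y (nearestPoint G y) ht
  have h2 := hX.dist_nearest_le h.convex_right (h.nearest_mem x) (h.nearest_mem y)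
    (h.dist_right hx |>.trans (h.infDist_left x hx).symm).le
    (h.dist_right hy |>.trans (h.infDist_left y hy).symm).le
  have h3 := mul_le_mul_of_nonneg_left h2 ht.1
  rw [strip, strip]
  linarith

theorem dist_strip_same (h : hX.AreParallel F G D) {x : X} (hx : x ∈ F) {s t : ℝ}
    (hs : s ∈ Set.Icc (0 : ℝ) 1) (ht : t ∈ Set.Icc (0 : ℝ) 1) :
    dist (hX.strip G s x) (hX.strip G t x) = |s - t| * D := by
  rw [strip, strip, hX.dist_geo_geo _ _ hs ht, h.dist_right hx]

theorem dist_left_strip (h : hX.AreParallel F G D) {x : X} (hx : x ∈ F) {t : ℝ}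
    (ht : t ∈ Set.Icc (0 : ℝ) 1) : dist x (hX.strip G t x) = t * D := by
  rw [strip, hX.dist_left_geo _ _ ht, h.dist_right hx]

theorem dist_strip_right (h : hX.AreParallel F G D) {x : X} (hx : x ∈ F) {t : ℝ}
    (ht : t ∈ Set.Icc (0 : ℝ) 1) : dist (hX.strip G t x) (nearestPoint G x) = (1 - t) * D := by
  rw [strip, hX.dist_geo_right _ _ ht, h.dist_right hx]

theorem dist_strip_strip (h : hX.AreParallel F G D) {x y : X} (hx : x ∈ F) (hy : y ∈ F) {t : ℝ}
    (ht : t ∈ Set.Icc (0 : ℝ) 1) : dist (hX.strip G t x) (hX.strip G t y) = dist x y := by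
  refine le_antisymm (h.dist_strip_strip_le hx hy ht) ?_
  -- Each `w` is the projection to `F` of its strip point, since the far end of the strip has
  -- distance `D` from `F`; projection is 1-Lipschitz.
  have key : ∀ w ∈ F, dist (hX.strip G t w) w ≤ Metric.infDist (hX.strip G t w) F := by
    intro w hw
    have h1 := Metric.infDist_le_dist_add F (nearestPoint G w) (hX.strip G t w)
    rw [h.infDist_right _ (h.nearest_mem w), dist_comm, h.dist_strip_right hw ht] at h1
    rw [dist_comm, h.dist_left_strip hw ht]
    linarith
  exact hX.dist_nearest_le h.convex_left hx hy (key x hx) (key y hy)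

theorem le_dist_between (h : hX.AreParallel F G D) {s t : ℝ} {z w : X}
    (hz : z ∈ between F G D s) (hw : w ∈ between F G D t) : |s - t| * D ≤ dist z w := by
  have key : ∀ {s t : ℝ} {z w : X}, z ∈ between F G D s → w ∈ between F G D t →
      (t - s) * D ≤ dist z w := by
    intro s t z w hz hw
    have h1 := Metric.infDist_le_dist_add G (nearestPoint F z) z
    have h2 := Metric.infDist_le_dist_add G z w
    rw [h.infDist_left _ (nearestPoint_mem h.isClosed_left h.nonempty_left z), dist_comm,
      dist_nearestPoint h.isClosed_left h.nonempty_left] at h1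
    linarith [hz.1, hw.2]
  rcases abs_cases (s - t) with ⟨h', -⟩ | ⟨h', -⟩
  · rw [h', dist_comm]; exact key hw hz
  · rw [h', neg_sub]; exact key hz hw

/-- Two parallel sets span a product with an interval. -/
theorem dist_strip_strip_sq (h : hX.AreParallel F G D) {x y : X} (hx : x ∈ F) (hy : y ∈ F)
    {s t : ℝ} (hs : s ∈ Set.Icc (0 : ℝ) 1) (ht : t ∈ Set.Icc (0 : ℝ) 1) :
    dist (hX.strip G s x) (hX.strip G t y) ^ 2 = ((s - t) * D) ^ 2 + dist x y ^ 2 := by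
  -- The slice at `t` is convex and the strip through `x` meets it at its nearest point, so the
  -- angle there is at least right. The quadrilateral inequality then forces equality for both
  -- diagonals.
  have key : ∀ {x y : X}, x ∈ F → y ∈ F →
      ((s - t) * D) ^ 2 + dist x y ^ 2 ≤ dist (hX.strip G s x) (hX.strip G t y) ^ 2 := by
    intro x y hx hy
    have h1 : dist (hX.strip G s x) (hX.strip G t x) ≤
        Metric.infDist (hX.strip G s x) (between F G D t) := by
      rw [h.dist_strip_same hx hs ht]
      exact (Metric.le_infDist ⟨_, h.strip_mem_between hx ht⟩).2 fun w hw =>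
        h.le_dist_between (h.strip_mem_between hx hs) hw
    have h2 := hX.dist_sq_add_dist_sq_le_of_nearest (h.geoConvex_between t)
      (h.strip_mem_between hx ht) (h.strip_mem_between hy ht) h1
    rwa [h.dist_strip_same hx hs ht, h.dist_strip_strip hx hy ht, mul_pow, sq_abs,
      ← mul_pow] at h2
  have h1 := key hx hy
  have h2 := key hy hx
  have h3 := hX.dist_sq_add_dist_sq_le (hX.strip G s x) (hX.strip G s y) (hX.strip G t y)
    (hX.strip G t x)
  rw [h.dist_strip_strip hx hy hs, h.dist_strip_strip hy hx ht, h.dist_strip_same hy hs ht,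
    dist_comm _ (hX.strip G s x), h.dist_strip_same hx hs ht, mul_pow, sq_abs, ← mul_pow,
    dist_comm y x] at h3
  rw [dist_comm y x] at h2
  linarith

theorem eq_of_zero (h : hX.AreParallel F G 0) : F = G := by
  have key : ∀ {F G : Set X}, hX.AreParallel F G 0 → F ⊆ G := by
    intro F G h x hx
    have := h.dist_right hx
    rw [dist_eq_zero.1 this]
    exact h.nearest_mem x
  exact (key h).antisymm (key h.symm)

end AreParallel

end IsCAT0

/-- A convex function bounded above on a whole vector space is constant: `y` is at parameter `1 / (n
+ 1)` between `x` and a point arbitrarily far out on the ray through `y`, where the value is still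
at most `B`. -/
theorem eq_of_lineMap_le_of_le {V : Type*} [NormedAddCommGroup V] [NormedSpace ℝ V] {f : V → ℝ}
    {B : ℝ} (hB : ∀ x, f x ≤ B) (hf : ∀ x y : V, ∀ t ∈ Set.Icc (0 : ℝ) 1,
      f (AffineMap.lineMap x y t) ≤ (1 - t) * f x + t * f y) (x y : V) : f x = f y := by
  have key : ∀ x y, f y ≤ f x := by
    intro x y
    have h1 : ∀ n : ℕ, f y ≤ (1 - 1 / ((n : ℝ) + 1)) * f x + 1 / ((n : ℝ) + 1) * B := by
      intro n
      have hn : (0 : ℝ) < (n : ℝ) + 1 := by positivity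
      have hn1 : 1 / ((n : ℝ) + 1) ≤ 1 := by
        rw [div_le_one hn]; linarith [(Nat.cast_nonneg n : (0 : ℝ) ≤ n)]
      have := hf x (AffineMap.lineMap x y ((n : ℝ) + 1)) (1 / ((n : ℝ) + 1))
        ⟨by positivity, hn1⟩
      have e : (AffineMap.lineMap x (AffineMap.lineMap x y ((n : ℝ) + 1) : V)
          (1 / ((n : ℝ) + 1)) : V) = y := by
        rw [AffineMap.lineMap_lineMap_right, one_div, inv_mul_cancel₀ hn.ne',
          AffineMap.lineMap_apply_one]
      rw [e] at this
      have h2 := mul_le_mul_of_nonneg_left (hB (AffineMap.lineMap x y ((n : ℝ) + 1)))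
        (by positivity : 0 ≤ 1 / ((n : ℝ) + 1))
      linarith
    have h2 : Filter.Tendsto (fun n : ℕ => (1 - 1 / ((n : ℝ) + 1)) * f x + 1 / ((n : ℝ) + 1) * B)
        Filter.atTop (nhds ((1 - 0) * f x + 0 * B)) :=
      ((tendsto_const_nhds.sub tendsto_one_div_add_atTop_nhds_zero_nat).mul_const _).add
        (tendsto_one_div_add_atTop_nhds_zero_nat.mul_const _)
    have h3 := ge_of_tendsto' h2 h1
    linarith
  exact le_antisymm (key y x) (key x y)

namespace IsCAT0

variable {X : Type v} [MetricSpace X] (hX : IsCAT0 X)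

theorem infDist_const {V : Type*} [NormedAddCommGroup V] [NormedSpace ℝ V] {f : V → X}
    (hf : Isometry f) {G : Set X} (hG : hX.GeoConvex G) (hne : G.Nonempty) {r : ℝ}
    (hr : ∀ v, Metric.infDist (f v) G ≤ r) (v w : V) :
    Metric.infDist (f v) G = Metric.infDist (f w) G := by
  refine eq_of_lineMap_le_of_le (f := fun v => Metric.infDist (f v) G) hr (fun x y t ht => ?_) v w
  rw [hX.map_lineMap hf x y ht]
  exact hX.infDist_geo_le hG hne _ _ ht

/-- Isometrically embedded normed spaces at finite Hausdorff distance are parallel. -/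
theorem areParallel_range [ProperSpace X] {V W : Type*} [NormedAddCommGroup V] [NormedSpace ℝ V]
    [CompleteSpace V]
    [NormedAddCommGroup W] [NormedSpace ℝ W] [CompleteSpace W] {f : V → X} {g : W → X}
    (hf : Isometry f) (hg : Isometry g) {r s : ℝ}
    (hr : ∀ v, Metric.infDist (f v) (Set.range g) ≤ r)
    (hs : ∀ w, Metric.infDist (g w) (Set.range f) ≤ s) :
    ∃ D ≤ r, hX.AreParallel (Set.range f) (Set.range g) D := by
  have c1 : IsClosed (Set.range f) := hf.isClosedEmbedding.isClosed_range
  have c2 : IsClosed (Set.range g) := hg.isClosedEmbedding.isClosed_range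
  have n1 := Set.range_nonempty f
  have n2 := Set.range_nonempty g
  have g1 := hX.geoConvex_range hf
  have g2 := hX.geoConvex_range hg
  have e1 := hX.infDist_const hf g2 n2 hr
  have e2 := hX.infDist_const hg g1 n1 hs
  have a1 : ∀ v w, Metric.infDist (g w) (Set.range f) ≤ Metric.infDist (f v) (Set.range g) := by
    intro v w
    obtain ⟨w', hw'⟩ := nearestPoint_mem c2 n2 (f v)
    rw [← dist_nearestPoint c2 n2, ← hw', e2 w w', dist_comm]
    exact Metric.infDist_le_dist_of_mem ⟨v, rfl⟩
  have a2 : ∀ v w, Metric.infDist (f v) (Set.range g) ≤ Metric.infDist (g w) (Set.range f) := by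
    intro v w
    obtain ⟨v', hv'⟩ := nearestPoint_mem c1 n1 (g w)
    rw [← dist_nearestPoint c1 n1, ← hv', e1 v v', dist_comm]
    exact Metric.infDist_le_dist_of_mem ⟨w, rfl⟩
  refine ⟨Metric.infDist (f 0) (Set.range g), hr 0, c1, c2, g1, g2, n1, n2, ?_, ?_⟩
  · rintro _ ⟨v, rfl⟩; exact e1 v 0
  · rintro _ ⟨w, rfl⟩; exact le_antisymm (a1 0 w) (a2 0 w)

end IsCAT0

/-! ### Limits along an ultrafilter, which avoid choosing diagonal subsequences. -/

theorem exists_tendsto_ultrafilter {X : Type*} [TopologicalSpace X] {ι : Type*}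
    (U : Ultrafilter ι) {K : Set X} (hK : IsCompact K) {u : ι → X} (hu : ∀ᶠ n in U, u n ∈ K) :
    ∃ x ∈ K, Filter.Tendsto u U (nhds x) := by
  obtain ⟨x, hx, h⟩ := hK.ultrafilter_le_nhds' (U.map u) hu
  exact ⟨x, hx, h⟩

theorem exists_eventually_eq_ultrafilter {α ι : Type*} (U : Ultrafilter ι) {S : Set α}
    (hS : S.Finite) {u : ι → α} (hu : ∀ᶠ n in U, u n ∈ S) : ∃ a ∈ S, ∀ᶠ n in U, u n = a := by
  obtain ⟨a, ha, h⟩ := Ultrafilter.eq_pure_of_finite_mem (f := U.map u) hS hu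
  refine ⟨a, ha, ?_⟩
  have : {a} ∈ U.map u := by rw [h]; exact Set.mem_singleton a
  exact this

/-! ### Proper cocompact actions: compactness and displacement. -/

section Action

variable {Γ : Type u} [Group Γ] {X : Type v} [MetricSpace X] [MulAction Γ X] [IsIsometricSMul Γ X]

/-- A small ball at `k` meets only finitely many translates of the compact fundamental set: cover
that set by finitely many balls of radius `r / 4`, each reaching the ball at `k` under finitely many
elements. -/
theorem IsProperAction.exists_isCompact_closedBall (hp : IsProperAction Γ X)
    (hc : IsCocompactAction Γ X) (k : X) : ∃ ε > 0, IsCompact (Metric.closedBall k ε) := by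
  obtain ⟨r, hr, hfin⟩ := hp k
  obtain ⟨K, hK, hKu⟩ := hc
  have hS : ∀ y : X, {g : Γ | ∃ z ∈ Metric.ball y (r / 4),
      g • z ∈ Metric.ball k (r / 4)}.Finite := by
    intro y
    rcases Set.eq_empty_or_nonempty {g : Γ | ∃ z ∈ Metric.ball y (r / 4),
      g • z ∈ Metric.ball k (r / 4)} with h | ⟨g₀, z₀, hz₀, hgz₀⟩
    · rw [h]; exact Set.finite_empty
    refine (hfin.image (· * g₀)).subset ?_
    rintro g ⟨z, hz, hgz⟩
    -- `g₀ • z` is within `r / 2 + r / 4` of `k`, so `g * g₀⁻¹` moves a point of the `r`-ball into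
    -- the `r`-ball.
    refine ⟨g * g₀⁻¹, ⟨g • z, ?_, ?_⟩, by simp⟩
    · refine ⟨g₀ • z, ?_, by simp [smul_smul]⟩
      rw [Metric.mem_ball] at *
      have h1 := dist_triangle (g₀ • z) (g₀ • z₀) k
      have h2 := dist_triangle_right z z₀ y
      rw [dist_smul] at h1
      linarith
    · rw [Metric.mem_ball] at *; linarith
  obtain ⟨t, -, htf, ht⟩ := hK.finite_cover_balls (e := r / 4) (by positivity)
  have hfinU : (⋃ y ∈ t, {g : Γ | ∃ z ∈ Metric.ball y (r / 4),
      g • z ∈ Metric.ball k (r / 4)}).Finite := htf.biUnion fun y _ => hS y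
  refine ⟨r / 8, by positivity, ?_⟩
  refine (hfinU.isCompact_biUnion fun g _ => hK.smul g).of_isClosed_subset
    Metric.isClosed_closedBall ?_
  intro w hw
  have : w ∈ ⋃ g : Γ, g • K := hKu ▸ Set.mem_univ w
  obtain ⟨g, hg⟩ := Set.mem_iUnion.1 this
  obtain ⟨z, hz, rfl⟩ := hg
  obtain ⟨y, hy, hzy⟩ := Set.mem_iUnion₂.1 (ht hz)
  refine Set.mem_iUnion₂.2 ⟨g, Set.mem_iUnion₂.2 ⟨y, hy, z, hzy, ?_⟩, z, hz, rfl⟩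
  exact Metric.closedBall_subset_ball (by linarith) hw

theorem IsProperAction.exists_forall_isCompact_closedBall (hp : IsProperAction Γ X)
    (hc : IsCocompactAction Γ X) : ∃ δ > 0, ∀ x : X, IsCompact (Metric.closedBall x δ) := by
  have : WeaklyLocallyCompactSpace X := ⟨fun x => by
    obtain ⟨ε, hε, h⟩ := hp.exists_isCompact_closedBall hc x
    exact ⟨_, h, Metric.closedBall_mem_nhds x hε⟩⟩
  obtain ⟨K, hK, hKu⟩ := hc
  obtain ⟨K', hK', hKK'⟩ := exists_compact_superset hK
  obtain ⟨δ, hδ, h⟩ := hK.exists_cthickening_subset_open isOpen_interior hKK'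
  refine ⟨δ, hδ, fun x => ?_⟩
  have : x ∈ ⋃ g : Γ, g • K := hKu ▸ Set.mem_univ x
  obtain ⟨g, hg⟩ := Set.mem_iUnion.1 this
  obtain ⟨k, hk, rfl⟩ := hg
  have h1 : IsCompact (Metric.closedBall k δ) := hK'.of_isClosed_subset
    Metric.isClosed_closedBall ((Metric.closedBall_subset_cthickening hk δ).trans
      (h.trans interior_subset))
  have := h1.smul g
  rwa [Metric.smul_closedBall] at this

/-- A geodesic space whose closed balls of some fixed radius are compact is proper. -/
theorem IsCAT0.properSpace_of_isCompact_closedBall (hX : IsCAT0 X) {δ : ℝ} (hδ : 0 < δ)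
    (h : ∀ x : X, IsCompact (Metric.closedBall x δ)) : ProperSpace X := by
  have key : ∀ x : X, ∀ n : ℕ, IsCompact (Metric.closedBall x (n * (δ / 2))) := by
    intro x n
    induction n with
    | zero => simp
    | succ n ih =>
      -- A point of the next ball is within `δ / 2` of the previous one, hence within `δ` of one of
      -- finitely many centres.
      obtain ⟨t, -, htf, ht⟩ := ih.finite_cover_balls (e := δ / 2) (by positivity)
      refine (htf.isCompact_biUnion fun y _ => h y).of_isClosed_subset
        Metric.isClosed_closedBall ?_
      intro y hy
      rw [Metric.mem_closedBall, dist_comm] at hy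
      push_cast at hy
      obtain ⟨z, hz, hzy⟩ : ∃ z, dist x z ≤ n * (δ / 2) ∧ dist z y ≤ δ / 2 := by
        rcases le_or_gt (dist x y) (n * (δ / 2)) with h1 | h1
        · exact ⟨y, h1, by simp; positivity⟩
        have h0 : 0 ≤ n * (δ / 2) := by positivity
        have hpos : 0 < dist x y := h0.trans_lt h1
        have hs : n * (δ / 2) / dist x y ∈ Set.Icc (0 : ℝ) 1 :=
          ⟨by positivity, (div_le_one hpos).2 h1.le⟩
        refine ⟨hX.geo x y (n * (δ / 2) / dist x y), ?_, ?_⟩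
        · rw [hX.dist_left_geo _ _ hs, div_mul_cancel₀ _ hpos.ne']
        · rw [hX.dist_geo_right _ _ hs, sub_mul, div_mul_cancel₀ _ hpos.ne']; linarith
      obtain ⟨w, hw, hzw⟩ := Set.mem_iUnion₂.1 (ht (by rwa [Metric.mem_closedBall, dist_comm]))
      refine Set.mem_iUnion₂.2 ⟨w, hw, ?_⟩
      rw [Metric.mem_ball] at hzw
      rw [Metric.mem_closedBall]
      linarith [dist_triangle_left y w z]
  refine ⟨fun x r => ?_⟩
  obtain ⟨n, hn⟩ := exists_nat_ge (r / (δ / 2))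
  exact (key x n).of_isClosed_subset Metric.isClosed_closedBall
    (Metric.closedBall_subset_closedBall ((div_le_iff₀ (by positivity)).1 hn))

theorem IsProperAction.properSpace (hp : IsProperAction Γ X) (hX : IsCAT0 X)
    (hc : IsCocompactAction Γ X) : ProperSpace X := by
  obtain ⟨δ, hδ, h⟩ := hp.exists_forall_isCompact_closedBall hc
  exact hX.properSpace_of_isCompact_closedBall hδ h

theorem IsProperAction.finite_dist_le {Γ : Type u} [Group Γ] {X : Type v} [MetricSpace X]
    [MulAction Γ X] [ProperSpace X] (hp : IsProperAction Γ X) (x y : X) (R : ℝ) :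
    {g : Γ | dist (g • x) y ≤ R}.Finite := by
  choose r hr hfin using hp
  obtain ⟨t, -, ht⟩ := (isCompact_closedBall y R).elim_nhds_subcover
    (fun z => Metric.ball z (r z)) fun z _ => Metric.ball_mem_nhds z (hr z)
  have hS : ∀ z : X, {g : Γ | g • x ∈ Metric.ball z (r z)}.Finite := by
    intro z
    rcases Set.eq_empty_or_nonempty {g : Γ | g • x ∈ Metric.ball z (r z)} with h | ⟨g₀, hg₀⟩
    · rw [h]; exact Set.finite_empty
    refine ((hfin z).image (· * g₀)).subset ?_
    intro g hg
    exact ⟨g * g₀⁻¹, ⟨g • x, ⟨g₀ • x, hg₀, by simp [smul_smul]⟩, hg⟩, by simp⟩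
  refine (t.finite_toSet.biUnion fun z _ => hS z).subset ?_
  intro g hg
  obtain ⟨z, hz, h⟩ := Set.mem_iUnion₂.1 (ht (Metric.mem_closedBall.2 hg))
  exact Set.mem_iUnion₂.2 ⟨z, hz, h⟩

/-- Points which `a` displaces by a bounded amount can be translated into a compact set in such a
way that `a` is conjugated to the same element almost always. -/
theorem IsProperAction.exists_recenter [ProperSpace X] (hp : IsProperAction Γ X)
    (hc : IsCocompactAction Γ X) (U : Ultrafilter ℕ) (a : Γ) {z : ℕ → X} {R : ℝ}
    (hz : ∀ n, dist (a • z n) (z n) ≤ R) :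
    ∃ (K : Set X) (h : ℕ → Γ) (h₀ : Γ), IsCompact K ∧ (∀ n, h n • z n ∈ K) ∧
      ∀ᶠ n in U, h n * a * (h n)⁻¹ = h₀ * a * h₀⁻¹ := by
  obtain ⟨K, hK, hKu⟩ := hc
  have hex : ∀ n, ∃ g : Γ, g • z n ∈ K := by
    intro n
    have : z n ∈ ⋃ g : Γ, g • K := hKu ▸ Set.mem_univ _
    obtain ⟨g, hg⟩ := Set.mem_iUnion.1 this
    obtain ⟨k, hk, hkz⟩ := hg
    exact ⟨g⁻¹, by rw [← hkz]; simpa using hk⟩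
  choose h hh using hex
  obtain ⟨ρ, hρ⟩ := hK.isBounded.subset_closedBall (z 0)
  -- The conjugate of `a` by `h n` moves `h n • z n` by at most `R`, and that point is within `ρ` of
  -- `z 0`.
  have hfin := hp.finite_dist_le (z 0) (z 0) (2 * ρ + R)
  have hmem : ∀ᶠ n in U, h n * a * (h n)⁻¹ ∈ {g : Γ | dist (g • z 0) (z 0) ≤ 2 * ρ + R} := by
    refine Filter.Eventually.of_forall fun n => ?_
    have h1 : dist ((h n * a * (h n)⁻¹) • h n • z n) (h n • z n) ≤ R := by
      rw [smul_smul, inv_mul_cancel_right, mul_smul, dist_smul]; exact hz n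
    have h2 := hρ (hh n)
    rw [Metric.mem_closedBall] at h2
    have h3 := dist_triangle4 ((h n * a * (h n)⁻¹) • z 0) ((h n * a * (h n)⁻¹) • h n • z n)
      (h n • z n) (z 0)
    rw [dist_smul, dist_comm (z 0)] at h3
    change dist _ _ ≤ _
    linarith
  obtain ⟨a', -, ha'⟩ := exists_eventually_eq_ultrafilter U hfin hmem
  obtain ⟨n₀, hn₀⟩ := ha'.exists
  refine ⟨K, h, h n₀, hK, hh, ?_⟩
  filter_upwards [ha'] with n hn
  rw [hn, hn₀]

/-- Isometries in a proper cocompact action attain their minimal displacement. -/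
theorem IsProperAction.exists_minimal_displacement [Nonempty X] [ProperSpace X]
    (hp : IsProperAction Γ X) (hc : IsCocompactAction Γ X) (a : Γ) :
    ∃ x : X, ∀ y : X, dist (a • x) x ≤ dist (a • y) y := by
  set τ := ⨅ y : X, dist (a • y) y
  have hbdd : BddBelow (Set.range fun y : X => dist (a • y) y) :=
    ⟨0, by rintro _ ⟨y, rfl⟩; exact dist_nonneg⟩
  have hex : ∀ n : ℕ, ∃ z : X, dist (a • z) z < τ + 1 / ((n : ℝ) + 1) := fun n =>
    exists_lt_of_ciInf_lt (lt_add_of_pos_right τ (by positivity))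
  choose z hz using hex
  have hz1 : ∀ n, dist (a • z n) (z n) ≤ τ + 1 := fun n => by
    refine (hz n).le.trans (add_le_add_right ?_ _)
    rw [div_le_one (by positivity)]; linarith [(Nat.cast_nonneg n : (0 : ℝ) ≤ n)]
  obtain ⟨K, h, h₀, hK, hh, hev⟩ := hp.exists_recenter hc (Filter.hyperfilter ℕ) a hz1
  obtain ⟨w, -, hw⟩ := exists_tendsto_ultrafilter (Filter.hyperfilter ℕ) hK
    (Filter.Eventually.of_forall hh)
  refine ⟨h₀⁻¹ • w, fun y => le_trans ?_ (ciInf_le hbdd y)⟩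
  have e1 : dist (a • h₀⁻¹ • w) (h₀⁻¹ • w) = dist ((h₀ * a * h₀⁻¹) • w) w := by
    rw [← dist_smul h₀ (a • h₀⁻¹ • w), smul_inv_smul, smul_smul, smul_smul, mul_assoc]
  rw [e1]
  have t1 : Filter.Tendsto (fun n => dist ((h₀ * a * h₀⁻¹) • h n • z n) (h n • z n))
      (Filter.hyperfilter ℕ) (nhds (dist ((h₀ * a * h₀⁻¹) • w) w)) :=
    (((isometry_smul X (h₀ * a * h₀⁻¹)).continuous.tendsto w).comp hw).dist hw
  have t2 : Filter.Tendsto (fun n : ℕ => τ + 1 / ((n : ℝ) + 1))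
      (Filter.hyperfilter ℕ) (nhds (τ + 0)) :=
    (tendsto_const_nhds.add tendsto_one_div_add_atTop_nhds_zero_nat).mono_left
      Nat.hyperfilter_le_atTop
  rw [add_zero] at t2
  refine le_of_tendsto_of_tendsto t1 t2 ?_
  filter_upwards [hev] with n hn
  rw [← hn, smul_smul, inv_mul_cancel_right, mul_smul, dist_smul]
  exact (hz n).le

/-- The element `a` takes the midpoint of `y, a • y` to that of `a • y, a ^ 2 • y`, and these
midpoints are at most half of `dist (a ^ 2 • y) y` apart. -/
theorem IsCAT0.two_mul_le_dist_sq_smul (hX : IsCAT0 X) {a : Γ} {τ : ℝ}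
    (h : ∀ y : X, τ ≤ dist (a • y) y) (y : X) : 2 * τ ≤ dist (a ^ 2 • y) y := by
  have ht : (1 / 2 : ℝ) ∈ Set.Icc (0 : ℝ) 1 := by norm_num
  have h1 := h (hX.geo y (a • y) (1 / 2))
  rw [hX.smul_geo a _ _ ht, hX.geo_symm y _ ht] at h1
  have h2 := hX.dist_geo_geo_same_left_le (a • y) (a • a • y) y ht
  have h3 : (1 - 1 / 2 : ℝ) = 1 / 2 := by norm_num
  rw [h3] at h1
  rw [pow_two, mul_smul]
  linarith

theorem dist_pow_smul_le (a : Γ) (x : X) (n : ℕ) : dist (a ^ n • x) x ≤ n * dist (a • x) x := by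
  induction n with
  | zero => simp
  | succ n ih =>
    rw [pow_succ, mul_smul]
    have := dist_triangle (a ^ n • a • x) (a ^ n • x) x
    rw [dist_smul] at this
    push_cast
    linarith

/-- Doubling settles the exponents `2 ^ k`. Writing `2 ^ n` as `n + (m + 1)`, a deficit at `n` would
give one at `2 ^ n`. -/
theorem IsCAT0.dist_pow_smul (hX : IsCAT0 X) {a : Γ} {x : X}
    (h : ∀ y : X, dist (a • x) x ≤ dist (a • y) y) (n : ℕ) :
    dist (a ^ n • x) x = n * dist (a • x) x := by
  have h1 : ∀ k : ℕ, ∀ y : X, 2 ^ k * dist (a • x) x ≤ dist (a ^ (2 ^ k) • y) y := by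
    intro k
    induction k with
    | zero => simpa using h
    | succ k ih =>
      intro y
      have := hX.two_mul_le_dist_sq_smul ih y
      rw [← pow_mul, ← pow_succ] at this
      rw [pow_succ]; linarith
  refine le_antisymm (dist_pow_smul_le a x n) ?_
  obtain ⟨m, hm⟩ := Nat.exists_eq_add_of_lt (Nat.lt_two_pow_self (n := n))
  have h2 := h1 n x
  have h3 := dist_triangle (a ^ (2 ^ n) • x) (a ^ n • x) x
  have h4 : dist (a ^ (2 ^ n) • x) (a ^ n • x) = dist (a ^ (m + 1) • x) x := by
    rw [hm, add_assoc, pow_add, mul_smul, dist_smul]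
  have h5 := dist_pow_smul_le a x (m + 1)
  have h6 : (2 : ℝ) ^ n = n + m + 1 := by exact_mod_cast hm
  rw [h6] at h2
  push_cast at h5
  nlinarith

theorem IsCAT0.dist_zpow_smul (hX : IsCAT0 X) {a : Γ} {x : X}
    (h : ∀ y : X, dist (a • x) x ≤ dist (a • y) y) (n : ℤ) :
    dist (a ^ n • x) x = |(n : ℝ)| * dist (a • x) x := by
  obtain ⟨m, rfl | rfl⟩ := n.eq_nat_or_neg
  · simpa using hX.dist_pow_smul h m
  · rw [← dist_smul (a ^ (m : ℤ)), smul_smul, ← zpow_add]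
    simpa [dist_comm] using hX.dist_pow_smul h m

theorem IsCAT0.dist_zpow_smul_zpow_smul (hX : IsCAT0 X) {a : Γ} {x : X}
    (h : ∀ y : X, dist (a • x) x ≤ dist (a • y) y) (m n : ℤ) :
    dist (a ^ m • x) (a ^ n • x) = |(m - n : ℝ)| * dist (a • x) x := by
  have := hX.dist_zpow_smul h (m - n)
  rw [← dist_smul (a ^ n), smul_smul, ← zpow_add, add_sub_cancel] at this
  rw [this]; push_cast; rfl

end Action

/-! ### Axes, their parallel translates, and the flat-or-finite dichotomy. -/

section Axis

variable {Γ : Type u} [Group Γ] {X : Type v} [MetricSpace X] [MulAction Γ X] [IsIsometricSMul Γ X]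

/-- An isometry attaining a positive minimal displacement at `x` has an axis through `x`. -/
theorem IsCAT0.exists_axis (hX : IsCAT0 X) {a : Γ} {x : X}
    (h : ∀ y : X, dist (a • x) x ≤ dist (a • y) y) (hpos : 0 < dist (a • x) x) :
    ∃ L : ℝ → X, Isometry L ∧ L 0 = x ∧
      ∀ (n : ℤ) (t : ℝ), a ^ n • L t = L (t + n * dist (a • x) x) := by
  set τ := dist (a • x) x with hτ
  have hτ' : dist x (a • x) = τ := dist_comm _ _
  -- The translates of the geodesic from `x` to `a • x`, concatenated and parametrised in units of
  -- `τ`.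
  let P : ℝ → X := fun u => a ^ ⌊u⌋ • hX.geo x (a • x) (Int.fract u)
  have hfr : ∀ u : ℝ, Int.fract u ∈ Set.Icc (0 : ℝ) 1 := fun u =>
    ⟨Int.fract_nonneg u, (Int.fract_lt_one u).le⟩
  have hl : ∀ u : ℝ, dist (a ^ ⌊u⌋ • x) (P u) = Int.fract u * τ := fun u => by
    rw [dist_smul, hX.dist_left_geo _ _ (hfr u), hτ']
  have hr : ∀ u : ℝ, dist (P u) (a ^ (⌊u⌋ + 1) • x) = (1 - Int.fract u) * τ := fun u => by
    rw [zpow_add_one, mul_smul, dist_smul, hX.dist_geo_right _ _ (hfr u), hτ']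
  have hz : ∀ m n : ℤ, m ≤ n → dist (a ^ m • x) (a ^ n • x) = (n - m) * τ := fun m n hmn => by
    rw [hX.dist_zpow_smul_zpow_smul h, abs_sub_comm, abs_of_nonneg]
    exact sub_nonneg.2 (by exact_mod_cast hmn)
  have key : ∀ u w : ℝ, u ≤ w → dist (P u) (P w) = (w - u) * τ := by
    intro u w huw
    have e1 := hl u
    have e2 := hl w
    have e3 := hr u
    have e4 := hr w
    have f1 := Int.floor_add_fract u
    have f2 := Int.floor_add_fract w
    apply le_antisymm
    · rcases (Int.floor_le_floor huw).eq_or_lt with he | hlt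
      · have : Int.fract u ≤ Int.fract w := by
          have : (⌊u⌋ : ℝ) = ⌊w⌋ := by exact_mod_cast he
          linarith
        change dist (a ^ ⌊u⌋ • hX.geo x (a • x) (Int.fract u))
          (a ^ ⌊w⌋ • hX.geo x (a • x) (Int.fract w)) ≤ _
        rw [he, dist_smul, hX.dist_geo_geo _ _ (hfr u) (hfr w), hτ', abs_sub_comm,
          abs_of_nonneg (sub_nonneg.2 this), Int.fract, Int.fract, he]
        apply le_of_eq; ring
      · have h1 := dist_triangle4 (P u) (a ^ (⌊u⌋ + 1) • x) (a ^ ⌊w⌋ • x) (P w)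
        rw [e3, e2, hz _ _ hlt, Int.fract, Int.fract] at h1
        push_cast at h1
        linarith
    -- The orbit points enclosing `P u` and `P w` are as far apart as the path between them is long,
    -- so no part of it can be shortened.
    · have h1 := dist_triangle4 (a ^ ⌊u⌋ • x) (P u) (P w) (a ^ (⌊w⌋ + 1) • x)
      rw [e1, e4, hz _ _ ((Int.floor_le_floor huw).trans (by omega)), Int.fract, Int.fract] at h1
      push_cast at h1
      linarith
  have key2 : ∀ u w : ℝ, dist (P u) (P w) = |u - w| * τ := by
    intro u w
    rcases le_total u w with huw | huw
    · rw [key u w huw, abs_sub_comm, abs_of_nonneg (sub_nonneg.2 huw)]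
    · rw [dist_comm, key w u huw, abs_of_nonneg (sub_nonneg.2 huw)]
  refine ⟨fun t => P (t / τ), Isometry.of_dist_eq fun s t => ?_, ?_, fun n t => ?_⟩
  · rw [key2, ← sub_div, abs_div, abs_of_pos hpos, div_mul_cancel₀ _ hpos.ne', Real.dist_eq]
  · simp [P, hX.geo_zero]
  · change a ^ n • a ^ ⌊t / τ⌋ • hX.geo x (a • x) (Int.fract (t / τ)) =
      a ^ ⌊(t + n * τ) / τ⌋ • hX.geo x (a • x) (Int.fract ((t + n * τ) / τ))
    have : (t + n * τ) / τ = t / τ + n := by field_simp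
    rw [this, Int.floor_add_intCast, Int.fract_add_intCast, smul_smul, ← zpow_add, add_comm n]

theorem infDist_smul_set (g : Γ) (x : X) (C : Set X) :
    Metric.infDist (g • x) (g • C) = Metric.infDist x C :=
  Metric.infDist_image (isometry_smul X g)

theorem IsCAT0.AreParallel.smul_nearestPoint {hX : IsCAT0 X} [ProperSpace X] {F G : Set X} {D : ℝ}
    (h : hX.AreParallel F G D) {a : Γ} (hF : a • F = F) (hG : a • G = G) {x : X} (hx : x ∈ F) :
    a • nearestPoint G x = nearestPoint G (a • x) := by
  have h1 := Set.smul_mem_smul_set (a := a) hx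
  have h2 := Set.smul_mem_smul_set (a := a) (h.nearest_mem x)
  rw [hF] at h1
  rw [hG] at h2
  refine h.eq_nearestPoint h1 h2 ?_
  rw [dist_smul, h.dist_right hx]

theorem IsCAT0.AreParallel.smul_strip {hX : IsCAT0 X} [ProperSpace X] {F G : Set X} {D : ℝ}
    (h : hX.AreParallel F G D) {a : Γ} (hF : a • F = F) (hG : a • G = G) {x : X} (hx : x ∈ F)
    {t : ℝ} (ht : t ∈ Set.Icc (0 : ℝ) 1) : a • hX.strip G t x = hX.strip G t (a • x) := by
  rw [IsCAT0.strip, hX.smul_geo a _ _ ht, h.smul_nearestPoint hF hG hx, IsCAT0.strip]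

/-- The translates of an axis of `a` by elements commuting with `a` are parallel. -/
theorem IsCAT0.areParallel_axis (hX : IsCAT0 X) [ProperSpace X] {a c : Γ} (hac : Commute a c)
    {L : ℝ → X} (hL : Isometry L) {τ : ℝ} (hτ : 0 < τ)
    (haL : ∀ (n : ℤ) (t : ℝ), a ^ n • L t = L (t + n * τ)) :
    ∃ D, hX.AreParallel (Set.range L) (c • Set.range L) D := by
  have hL' : Isometry fun t => c • L t := (isometry_smul X c).comp hL
  have hr : (c • Set.range L) = Set.range fun t => c • L t := by
    rw [← Set.image_smul, ← Set.range_comp]; rfl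
  have hb : ∀ t, dist (L t) (c • L t) ≤ 2 * τ + dist (L 0) (c • L 0) := by
    intro t
    -- A power of `a`, which commutes with `c`, brings the point within `τ` of `L 0`.
    have e : L t = a ^ ⌊t / τ⌋ • L (t - ⌊t / τ⌋ * τ) := by rw [haL]; congr 1; ring
    have h1 : |t - ⌊t / τ⌋ * τ| ≤ τ := by
      have h2 : t = t / τ * τ := (div_mul_cancel₀ _ hτ.ne').symm
      have h3 := mul_le_mul_of_nonneg_right (Int.floor_le (t / τ)) hτ.le
      have h4 := mul_le_mul_of_nonneg_right (Int.lt_floor_add_one (t / τ)).le hτ.le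
      rw [abs_le]; constructor <;> linarith
    rw [e, ← mul_smul, ← ((hac.zpow_left ⌊t / τ⌋).eq), mul_smul, dist_smul]
    have h2 := dist_triangle4 (L (t - ⌊t / τ⌋ * τ)) (L 0) (c • L 0) (c • L (t - ⌊t / τ⌋ * τ))
    rw [dist_smul, hL.dist_eq, hL.dist_eq, dist_comm 0, Real.dist_eq, sub_zero] at h2
    linarith
  obtain ⟨D, -, hD⟩ := hX.areParallel_range hL hL' (r := 2 * τ + dist (L 0) (c • L 0))
    (s := 2 * τ + dist (L 0) (c • L 0))
    (fun t => (Metric.infDist_le_dist_of_mem (Set.mem_range_self t)).trans (hb t))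
    (fun t => (Metric.infDist_le_dist_of_mem (Set.mem_range_self t)).trans
      (by rw [dist_comm]; exact hb t))
  exact ⟨D, hr ▸ hD⟩

/-- If an axis of `a` has parallel translates arbitrarily far away, then `a` stabilises a flat. -/
theorem IsProperAction.exists_isFlat_smul_eq (hp : IsProperAction Γ X)
    (hc : IsCocompactAction Γ X) (hX : IsCAT0 X) [ProperSpace X] {a : Γ}
    {L : ℝ → X} (hL : Isometry L) {τ : ℝ}
    (haL : ∀ (n : ℤ) (t : ℝ), a ^ n • L t = L (t + n * τ))
    (hfar : ∀ n : ℕ, ∃ c : Γ, Commute a c ∧ ∃ D, (n : ℝ) ≤ D ∧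
      hX.AreParallel (Set.range L) (c • Set.range L) D) :
    ∃ F : Set X, IsFlat F ∧ a • F = F := by
  choose c hac D hnD hpar using hfar
  have haR : a • Set.range L = Set.range L := by
    ext z
    rw [Set.mem_smul_set]
    have haL1 : ∀ t, a • L t = L (t + τ) := fun t => by simpa using haL 1 t
    constructor
    · rintro ⟨_, ⟨t, rfl⟩, rfl⟩; exact ⟨t + τ, (haL1 t).symm⟩
    · rintro ⟨t, rfl⟩; exact ⟨L (t - τ), ⟨_, rfl⟩, by rw [haL1]; simp⟩
  have haR' : ∀ n, a • c n • Set.range L = c n • Set.range L := fun n => by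
    rw [smul_smul, (hac n).eq, mul_smul, haR]
  have haL1 : ∀ t, a • L t = L (t + τ) := fun t => by simpa using haL 1 t
  have hhalf : (1 / 2 : ℝ) ∈ Set.Icc (0 : ℝ) 1 := by norm_num
  -- Coordinates on the strip between the axis and its translate by `c n`: `v 0` runs across it from
  -- the middle, `v 1` along it. They are meaningful once `|v 0| ≤ D n / 2`, so the properties below
  -- hold eventually.
  let S : ℕ → EuclideanSpace ℝ (Fin 2) → X := fun n v =>
    hX.strip (c n • Set.range L) (1 / 2 + v 0 / D n) (L (v 1))
  have hpar01 : ∀ v : EuclideanSpace ℝ (Fin 2), ∀ᶠ n in (Filter.hyperfilter ℕ : Filter ℕ),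
      0 < D n ∧ 1 / 2 + v 0 / D n ∈ Set.Icc (0 : ℝ) 1 := by
    intro v
    obtain ⟨N, hN⟩ := exists_nat_gt (2 * |v 0|)
    filter_upwards [Nat.hyperfilter_le_atTop (Filter.eventually_ge_atTop N)] with n hn
    have h1 : (N : ℝ) ≤ n := by exact_mod_cast hn
    have h2 := hnD n
    have h3 := abs_nonneg (v 0)
    have hD : 0 < D n := by linarith
    have h4 : |v 0 / D n| ≤ 1 / 2 := by
      rw [abs_div, abs_of_pos hD, div_le_iff₀ hD]; linarith
    rw [abs_le] at h4
    exact ⟨hD, by linarith, by linarith⟩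
  have hSdist : ∀ v w : EuclideanSpace ℝ (Fin 2), ∀ᶠ n in (Filter.hyperfilter ℕ : Filter ℕ),
      dist (S n v) (S n w) = dist v w := by
    intro v w
    filter_upwards [hpar01 v, hpar01 w] with n ⟨hD, h1⟩ ⟨_, h2⟩
    have h3 := (hpar n).dist_strip_strip_sq ⟨v 1, rfl⟩ ⟨w 1, rfl⟩ h1 h2
    have h4 : dist v w ^ 2 = (v 0 - w 0) ^ 2 + dist (v 1) (w 1) ^ 2 := by
      rw [EuclideanSpace.dist_eq, Real.sq_sqrt (by positivity), Fin.sum_univ_two,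
        Real.dist_eq (v 0), sq_abs]
    have h5 : (1 / 2 + v 0 / D n - (1 / 2 + w 0 / D n)) * D n = v 0 - w 0 := by
      field_simp; ring
    rw [h5, hL.dist_eq, ← h4] at h3
    exact (pow_left_inj₀ dist_nonneg dist_nonneg two_ne_zero).1 h3
  have hSa : ∀ v : EuclideanSpace ℝ (Fin 2), ∀ᶠ n in (Filter.hyperfilter ℕ : Filter ℕ),
      a • S n v = S n (v + !₂[0, τ]) := by
    intro v
    filter_upwards [hpar01 v] with n ⟨hD, h1⟩
    simp only [S]
    rw [(hpar n).smul_strip haR (haR' n) ⟨v 1, rfl⟩ h1, haL1]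
    simp
  have hz : ∀ n, dist (a • S n 0) (S n 0) ≤ |τ| := by
    intro n
    simp only [S, PiLp.zero_apply, zero_div, add_zero]
    rw [(hpar n).smul_strip haR (haR' n) ⟨0, rfl⟩ hhalf, haL1,
      (hpar n).dist_strip_strip ⟨_, rfl⟩ ⟨_, rfl⟩ hhalf, hL.dist_eq]
    simp
  -- Moving the strip centres into a compact set gives a limit plane `T`; the conjugates of `a` are
  -- eventually constant, so one of them translates `T`.
  obtain ⟨K, h, h₀, hK, hh, hev⟩ := hp.exists_recenter hc (Filter.hyperfilter ℕ) a hz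
  have hlim : ∀ v, ∃ x, Filter.Tendsto (fun n => h n • S n v) (Filter.hyperfilter ℕ) (nhds x) := by
    intro v
    obtain ⟨x, -, hx⟩ := exists_tendsto_ultrafilter (Filter.hyperfilter ℕ)
      (u := fun n => h n • S n v) (hK.cthickening (r := dist v 0)) (by
        filter_upwards [hSdist v 0] with n hn
        refine Metric.mem_cthickening_of_dist_le _ (h n • S n 0) _ _ (hh n) ?_
        rw [dist_smul, hn])
    exact ⟨x, hx⟩
  choose T hT using hlim
  have hTiso : Isometry T := Isometry.of_dist_eq fun v w => by
    refine tendsto_nhds_unique ((hT v).dist (hT w)) (tendsto_const_nhds.congr' ?_)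
    filter_upwards [hSdist v w] with n hn
    rw [dist_smul, hn]
  have hTa : ∀ v, (h₀ * a * h₀⁻¹) • T v = T (v + !₂[0, τ]) := by
    intro v
    refine tendsto_nhds_unique
      (((isometry_smul X (h₀ * a * h₀⁻¹)).continuous.tendsto _).comp (hT v))
      ((hT (v + !₂[0, τ])).congr' ?_)
    filter_upwards [hev, hSa v] with n hn hn'
    simp only [Function.comp]
    rw [← hn, smul_smul, inv_mul_cancel_right, mul_smul, hn']
  have hTr : (h₀ * a * h₀⁻¹) • Set.range T = Set.range T := by
    ext z
    rw [Set.mem_smul_set]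
    constructor
    · rintro ⟨_, ⟨v, rfl⟩, rfl⟩; exact ⟨_, (hTa v).symm⟩
    · rintro ⟨v, rfl⟩; exact ⟨_, ⟨v - !₂[0, τ], rfl⟩, by rw [hTa, sub_add_cancel]⟩
  refine ⟨h₀⁻¹ • Set.range T, ⟨2, le_rfl, fun v => h₀⁻¹ • T v,
    (isometry_smul X h₀⁻¹).comp hTiso, ?_⟩, ?_⟩
  · rw [← Set.image_smul, ← Set.range_comp]; rfl
  · rw [eq_inv_smul_iff, smul_smul, smul_smul, hTr]

/-- Either `a` stabilises a flat, or its centraliser is a finite union of cosets of `⟨a⟩`. -/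
theorem IsProperAction.exists_isFlat_or_finite (hp : IsProperAction Γ X)
    (hc : IsCocompactAction Γ X) (hX : IsCAT0 X) [ProperSpace X] {a : Γ} {x : X}
    (h : ∀ y : X, dist (a • x) x ≤ dist (a • y) y) (hpos : 0 < dist (a • x) x) :
    (∃ F : Set X, IsFlat F ∧ a • F = F) ∨
      ∃ S : Set Γ, S.Finite ∧ ∀ c, Commute a c → ∃ k : ℤ, c * a ^ k ∈ S := by
  obtain ⟨L, hL, hL0, haL⟩ := hX.exists_axis h hpos
  set τ := dist (a • x) x
  by_cases hfar : ∀ n : ℕ, ∃ c : Γ, Commute a c ∧ ∃ D, (n : ℝ) ≤ D ∧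
      hX.AreParallel (Set.range L) (c • Set.range L) D
  · exact Or.inl (hp.exists_isFlat_smul_eq hc hX hL haL hfar)
  push Not at hfar
  obtain ⟨n, hn⟩ := hfar
  refine Or.inr ⟨_, hp.finite_dist_le x x (n + τ), fun c hac => ?_⟩
  obtain ⟨D, hD⟩ := hX.areParallel_axis hac hL hpos haL
  have hDn : D < n := by
    by_contra hcon
    exact hn c hac D (not_lt.1 hcon) hD
  have hx : x ∈ Set.range L := ⟨0, hL0⟩
  obtain ⟨_, ⟨t, rfl⟩, ht⟩ := hD.nearest_mem x
  have h1 := hD.dist_right hx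
  rw [← ht] at h1
  -- The projection of `x` to the translated axis is `c • L t`; this power puts `c * a ^ k` of `x`
  -- within `τ` of it.
  refine ⟨⌊t / τ⌋, ?_⟩
  have h2 : dist ((c * a ^ ⌊t / τ⌋) • x) (c • L t) ≤ τ := by
    rw [mul_smul, dist_smul, ← hL0, haL, hL.dist_eq, Real.dist_eq]
    have h2 : t = t / τ * τ := (div_mul_cancel₀ _ hpos.ne').symm
    have h3 := mul_le_mul_of_nonneg_right (Int.floor_le (t / τ)) hpos.le
    have h4 := mul_le_mul_of_nonneg_right (Int.lt_floor_add_one (t / τ)).le hpos.le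
    rw [abs_le]; constructor <;> linarith
  have h3 := dist_triangle_right ((c * a ^ ⌊t / τ⌋) • x) x (c • L t)
  change dist _ _ ≤ _
  simp only at h1
  linarith

end Axis

/-! ### Flats up to finite Hausdorff distance. -/

section Coarse

variable {X : Type v} [MetricSpace X]

/-- Two sets at finite Hausdorff distance. -/
def AtFiniteDistance (E F : Set X) : Prop :=
  ∃ r : ℝ, (∀ x ∈ E, Metric.infDist x F ≤ r) ∧ ∀ x ∈ F, Metric.infDist x E ≤ r

theorem infDist_le_infDist_add {A C : Set X} (hA : A.Nonempty) {B : ℝ}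
    (h : ∀ y ∈ A, Metric.infDist y C ≤ B) (x : X) :
    Metric.infDist x C ≤ Metric.infDist x A + B := by
  refine le_of_forall_pos_le_add fun ε hε => ?_
  obtain ⟨y, hy, hxy⟩ := (Metric.infDist_lt_iff hA).1 (lt_add_of_pos_right (Metric.infDist x A) hε)
  have := Metric.infDist_le_dist_add C x y
  linarith [h y hy]

theorem AtFiniteDistance.refl (E : Set X) : AtFiniteDistance E E :=
  ⟨0, fun _ hx => (Metric.infDist_zero_of_mem hx).le, fun _ hx =>
    (Metric.infDist_zero_of_mem hx).le⟩

theorem AtFiniteDistance.symm {E F : Set X} (h : AtFiniteDistance E F) : AtFiniteDistance F E := by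
  obtain ⟨r, h1, h2⟩ := h
  exact ⟨r, h2, h1⟩

theorem AtFiniteDistance.trans {E F G : Set X} (hF : F.Nonempty)
    (h : AtFiniteDistance E F) (h' : AtFiniteDistance F G) : AtFiniteDistance E G := by
  obtain ⟨r, h1, h2⟩ := h
  obtain ⟨s, h3, h4⟩ := h'
  refine ⟨r + s, fun x hx => ?_, fun x hx => ?_⟩
  · linarith [infDist_le_infDist_add hF h3 x, h1 x hx]
  · linarith [infDist_le_infDist_add hF h2 x, h4 x hx]

theorem IsFlat.nonempty {E : Set X} (h : IsFlat E) : E.Nonempty := by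
  obtain ⟨k, -, f, -, rfl⟩ := h
  exact Set.range_nonempty f

theorem IsFlat.not_isBounded {E : Set X} (h : IsFlat E) : ¬ Bornology.IsBounded E := by
  obtain ⟨k, hk, f, hf, rfl⟩ := h
  intro hb
  have : Nonempty (Fin k) := ⟨⟨0, by omega⟩⟩
  have h1 := hf.antilipschitz.isBounded_preimage hb
  rw [Set.preimage_range] at h1
  exact NormedSpace.unbounded_univ ℝ (EuclideanSpace ℝ (Fin k)) h1

theorem IsCAT0.areParallel_of_isFlat (hX : IsCAT0 X) [ProperSpace X] {E F : Set X} (hE : IsFlat E)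
    (hF : IsFlat F) (h : AtFiniteDistance E F) : ∃ D, hX.AreParallel E F D := by
  obtain ⟨k, -, f, hf, rfl⟩ := hE
  obtain ⟨l, -, g, hg, rfl⟩ := hF
  obtain ⟨r, h1, h2⟩ := h
  obtain ⟨D, -, hD⟩ := hX.areParallel_range hf hg (fun v => h1 _ ⟨v, rfl⟩) (fun w => h2 _ ⟨w, rfl⟩)
  exact ⟨D, hD⟩

/-- A flat at finite distance from a flat that it contains equals it. -/
theorem IsCAT0.eq_of_isFlat_of_subset (hX : IsCAT0 X) [ProperSpace X] {E F : Set X} (hE : IsFlat E)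
    (hF : IsFlat F) (h : AtFiniteDistance E F) (hsub : E ⊆ F) : E = F := by
  obtain ⟨D, hD⟩ := hX.areParallel_of_isFlat hE hF h
  obtain ⟨x, hx⟩ := hE.nonempty
  have := hD.infDist_left x hx
  rw [Metric.infDist_zero_of_mem (hsub hx)] at this
  subst this
  exact hD.eq_of_zero

variable {Γ : Type u} [Group Γ] [MulAction Γ X] [IsIsometricSMul Γ X]

theorem IsFlat.smul {E : Set X} (h : IsFlat E) (g : Γ) : IsFlat (g • E) := by
  obtain ⟨k, hk, f, hf, rfl⟩ := h
  refine ⟨k, hk, fun v => g • f v, (isometry_smul X g).comp hf, ?_⟩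
  rw [← Set.image_smul, ← Set.range_comp]; rfl

theorem AtFiniteDistance.smul {E F : Set X} (h : AtFiniteDistance E F) (g : Γ) :
    AtFiniteDistance (g • E) (g • F) := by
  obtain ⟨r, h1, h2⟩ := h
  refine ⟨r, ?_, ?_⟩
  · rintro _ ⟨x, hx, rfl⟩
    exact (infDist_smul_set g x F).trans_le (h1 x hx)
  · rintro _ ⟨x, hx, rfl⟩
    exact (infDist_smul_set g x E).trans_le (h2 x hx)

theorem infDist_smul_set_eq (g : Γ) (x : X) (C : Set X) :
    Metric.infDist x (g • C) = Metric.infDist (g⁻¹ • x) C := by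
  rw [← infDist_smul_set g (g⁻¹ • x), smul_inv_smul]

end Coarse

/-! ### The circumcentre of a class of parallel flats. -/

section Centre

variable {X : Type v} [MetricSpace X]

/-- The flats parallel to `E`. -/
def parallelFlats (E : Set X) : Set (Set X) := {F | IsFlat F ∧ AtFiniteDistance F E}

/-- All flats parallel to `E` are in the `r`-neighbourhood of `F`. -/
def ParallelFlatsWithin (E F : Set X) (r : ℝ) : Prop :=
  ∀ G ∈ parallelFlats E, ∀ x ∈ G, Metric.infDist x F ≤ r

/-- The flat halfway between two parallel flats. -/
theorem IsCAT0.exists_midflat (hX : IsCAT0 X) [ProperSpace X] {E F₁ F₂ : Set X}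
    (h₁ : F₁ ∈ parallelFlats E) {r : ℝ}
    (hr₁ : ParallelFlatsWithin E F₁ r) (hr₂ : ParallelFlatsWithin E F₂ r) {D : ℝ}
    (hD : hX.AreParallel F₁ F₂ D) :
    ∃ M ∈ parallelFlats E, ∀ G ∈ parallelFlats E, ∀ x ∈ G,
      Metric.infDist x M ^ 2 ≤ r ^ 2 - D ^ 2 / 4 := by
  have ht : (1 / 2 : ℝ) ∈ Set.Icc (0 : ℝ) 1 := by norm_num
  have hflat : IsFlat (IsCAT0.between F₁ F₂ D (1 / 2)) := by
    obtain ⟨k, hk, f, hf, hfr⟩ := h₁.1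
    refine ⟨k, hk, fun v => hX.strip F₂ (1 / 2) (f v), Isometry.of_dist_eq fun v w => ?_, ?_⟩
    · rw [hD.dist_strip_strip (hfr ▸ ⟨v, rfl⟩) (hfr ▸ ⟨w, rfl⟩) ht, hf.dist_eq]
    · ext z
      constructor
      · rintro ⟨v, rfl⟩
        exact hD.strip_mem_between (hfr ▸ ⟨v, rfl⟩) ht
      · intro hz
        obtain ⟨x, hx, rfl⟩ := hD.exists_strip_eq ht hz
        rw [← hfr] at hx
        obtain ⟨v, rfl⟩ := hx
        exact ⟨v, rfl⟩
  refine ⟨_, ⟨hflat, AtFiniteDistance.trans h₁.1.nonempty ?_ h₁.2⟩, fun G hG x hx => ?_⟩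
  · refine ⟨1 / 2 * D, fun x hx => hx.1, fun x hx => ?_⟩
    rw [← hD.dist_left_strip hx ht]
    exact Metric.infDist_le_dist_of_mem (hD.strip_mem_between hx ht)
  · have m1 := nearestPoint_mem hD.isClosed_left hD.nonempty_left x
    have m2 := nearestPoint_mem hD.isClosed_right hD.nonempty_right x
    have d1 := (dist_nearestPoint hD.isClosed_left hD.nonempty_left x).trans_le (hr₁ G hG x hx)
    have d2 := (dist_nearestPoint hD.isClosed_right hD.nonempty_right x).trans_le (hr₂ G hG x hx)
    -- The midpoint of the two projections of `x` lies on the middle flat; as the projections are at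
    -- least `D` apart, the Bruhat–Tits inequality gains `D ^ 2 / 4`.
    have h3 := hX.dist_geo_sq_le (nearestPoint F₁ x) (nearestPoint F₂ x) x ht
    have h4 := Metric.infDist_le_dist_of_mem (x := x) (hD.geo_mem_between m1 m2 ht)
    have h5 := pow_le_pow_left₀ Metric.infDist_nonneg h4 2
    have h6 := pow_le_pow_left₀ dist_nonneg d1 2
    have h7 := pow_le_pow_left₀ dist_nonneg d2 2
    have h8 := pow_le_pow_left₀ hD.nonneg (hD.le_dist m1 m2) 2
    rw [dist_comm _ x, dist_comm _ x, dist_comm (nearestPoint F₂ x) x] at h3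
    linarith

/-- The flats parallel to `E` have a unique circumcentre. -/
theorem IsCAT0.exists_centre_flat (hX : IsCAT0 X) [ProperSpace X] {E : Set X} (hE : IsFlat E)
    {B : ℝ} (hB : ParallelFlatsWithin E E B) :
    ∃ (C : Set X) (r : ℝ), C ∈ parallelFlats E ∧ ParallelFlatsWithin E C r ∧
      ∀ C' ∈ parallelFlats E, ParallelFlatsWithin E C' r → C = C' := by
  have hEE : E ∈ parallelFlats E := ⟨hE, AtFiniteDistance.refl E⟩
  set R : Set ℝ := {r | 0 ≤ r ∧ ∃ F ∈ parallelFlats E, ParallelFlatsWithin E F r} with hR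
  have hR0 : ∀ F ∈ parallelFlats E, ∀ r, ParallelFlatsWithin E F r → r ∈ R := by
    intro F hF r hr
    obtain ⟨x, hx⟩ := hE.nonempty
    exact ⟨Metric.infDist_nonneg.trans (hr E hEE x hx), F, hF, hr⟩
  have hRne : R.Nonempty := ⟨B, hR0 E hEE B hB⟩
  have hRb : BddBelow R := ⟨0, fun r hr => hr.1⟩
  set r₀ := sInf R with hr₀
  have hr₀0 : 0 ≤ r₀ := le_csInf hRne fun r hr => hr.1
  have hmid : ∀ F₁ ∈ parallelFlats E, ∀ F₂ ∈ parallelFlats E, ParallelFlatsWithin E F₁ r₀ →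
      ParallelFlatsWithin E F₂ r₀ → F₁ = F₂ := by
    intro F₁ h₁ F₂ h₂ hr₁ hr₂
    obtain ⟨D, hD⟩ := hX.areParallel_of_isFlat h₁.1 h₂.1 (h₁.2.trans hE.nonempty h₂.2.symm)
    obtain ⟨M, hM, hM'⟩ := hX.exists_midflat h₁ hr₁ hr₂ hD
    -- Distinct centres have `D > 0`, and the flat halfway between them would beat the infimum `r₀`.
    have h3 : Real.sqrt (r₀ ^ 2 - D ^ 2 / 4) ∈ R :=
      hR0 M hM _ fun G hG x hx => Real.le_sqrt_of_sq_le (hM' G hG x hx)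
    have h4 := csInf_le hRb h3
    obtain ⟨x, hx⟩ := hE.nonempty
    have h5 := (sq_nonneg _).trans (hM' E hEE x hx)
    have h6 := pow_le_pow_left₀ hr₀0 h4 2
    rw [Real.sq_sqrt h5] at h6
    have h7 : D ^ 2 = 0 := le_antisymm (by linarith) (sq_nonneg D)
    rw [pow_eq_zero_iff two_ne_zero] at h7
    subst h7
    exact hD.eq_of_zero
  have hex : ∀ n : ℕ, ∃ F ∈ parallelFlats E, ParallelFlatsWithin E F (r₀ + 1 / ((n : ℝ) + 1)) := by
    intro n
    obtain ⟨r, ⟨-, F, hF, hr⟩, hlt⟩ := exists_lt_of_csInf_lt hRne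
      (lt_add_of_pos_right r₀ (by positivity : 0 < 1 / ((n : ℝ) + 1)))
    exact ⟨F, hF, fun G hG x hx => (hr G hG x hx).trans hlt.le⟩
  choose F hF hFr using hex
  choose D hD using fun n => hX.areParallel_of_isFlat hE (hF n).1 (hF n).2.symm
  have hone : (1 : ℝ) ∈ Set.Icc (0 : ℝ) 1 := by norm_num
  have hDB : ∀ n, D n ≤ B := by
    intro n
    obtain ⟨y, hy⟩ := (hF n).1.nonempty
    rw [← (hD n).infDist_right y hy]
    exact hB _ (hF n) y hy
  obtain ⟨k, hk, f, hf, hfr⟩ := hE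
  have hfE : ∀ v, f v ∈ E := fun v => hfr ▸ ⟨v, rfl⟩
  -- All the nearly optimal flats are parametrised by `E` along strips of width at most `B`, so they
  -- have a pointwise limit.
  let q : ℕ → EuclideanSpace ℝ (Fin k) → X := fun n v => hX.strip (F n) 1 (f v)
  have hq : ∀ n v w, dist (q n v) (q n w) = dist v w := fun n v w => by
    rw [(hD n).dist_strip_strip (hfE v) (hfE w) hone, hf.dist_eq]
  have hqf : ∀ n v, dist (q n v) (f v) ≤ B := fun n v => by
    rw [dist_comm, (hD n).dist_left_strip (hfE v) hone, one_mul]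
    exact hDB n
  have hlim : ∀ v, ∃ x ∈ Metric.closedBall (f v) B,
      Filter.Tendsto (fun n => q n v) (Filter.hyperfilter ℕ) (nhds x) := fun v =>
    exists_tendsto_ultrafilter _ (isCompact_closedBall (f v) B)
      (Filter.Eventually.of_forall fun n => hqf n v)
  choose c hcB hc using hlim
  have hciso : Isometry c := Isometry.of_dist_eq fun v w => by
    refine tendsto_nhds_unique ((hc v).dist (hc w)) ?_
    simp only [hq]
    exact tendsto_const_nhds
  have hCP : Set.range c ∈ parallelFlats E := by
    refine ⟨⟨k, hk, c, hciso, rfl⟩, B, ?_, ?_⟩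
    · rintro _ ⟨v, rfl⟩
      exact (Metric.infDist_le_dist_of_mem (hfE v)).trans (hcB v)
    · intro x hx
      rw [← hfr] at hx
      obtain ⟨v, rfl⟩ := hx
      refine (Metric.infDist_le_dist_of_mem (Set.mem_range_self v)).trans ?_
      rw [dist_comm]
      exact hcB v
  have hCr : ParallelFlatsWithin E (Set.range c) r₀ := by
    intro G hG x hx
    have hv : ∀ n, ∃ v, dist x (q n v) ≤ r₀ + 1 / ((n : ℝ) + 1) := by
      intro n
      have hm := (hD n).nearest_mem x
      obtain ⟨z, hz, hz'⟩ := (hD n).exists_strip_eq hone (z := nearestPoint (F n) x)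
        ⟨by rw [(hD n).infDist_right _ hm, one_mul],
          by rw [Metric.infDist_zero_of_mem hm, sub_self, zero_mul]⟩
      rw [← hfr] at hz
      obtain ⟨v, rfl⟩ := hz
      refine ⟨v, ?_⟩
      change dist x (hX.strip (F n) 1 (f v)) ≤ _
      rw [hz', dist_nearestPoint (hD n).isClosed_right (hD n).nonempty_right]
      exact hFr n G hG x hx
    choose v hv using hv
    -- The parameters of the projections of `x` stay bounded; their limit parametrises a point of
    -- the limit flat within `r₀` of `x`.
    obtain ⟨w, -, hw⟩ := exists_tendsto_ultrafilter (Filter.hyperfilter ℕ)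
      (isCompact_closedBall (0 : EuclideanSpace ℝ (Fin k)) (r₀ + 1 + dist x (f 0) + B))
      (u := v) (Filter.Eventually.of_forall fun n => by
        rw [Metric.mem_closedBall, ← hq n]
        have h1 := dist_triangle4 (q n (v n)) x (f 0) (q n 0)
        rw [dist_comm _ x, dist_comm (f 0)] at h1
        have h2 := hqf n 0
        have h3 := hv n
        have h4 : 1 / ((n : ℝ) + 1) ≤ 1 := by
          rw [div_le_one (by positivity)]; linarith [(Nat.cast_nonneg n : (0 : ℝ) ≤ n)]
        linarith)
    have h1 : ∀ n : ℕ, dist x (c w) ≤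
        r₀ + 1 / ((n : ℝ) + 1) + dist (v n) w + dist (q n w) (c w) := fun n => by
      have := dist_triangle4 x (q n (v n)) (q n w) (c w)
      rw [hq] at this
      linarith [hv n]
    have h2 : Filter.Tendsto
        (fun n : ℕ => r₀ + 1 / ((n : ℝ) + 1) + dist (v n) w + dist (q n w) (c w))
        (Filter.hyperfilter ℕ) (nhds (r₀ + 0 + dist w w + dist (c w) (c w))) :=
      (((tendsto_const_nhds.add (tendsto_one_div_add_atTop_nhds_zero_nat.mono_left
        Nat.hyperfilter_le_atTop)).add (hw.dist tendsto_const_nhds)).add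
        ((hc w).dist tendsto_const_nhds))
    rw [dist_self, dist_self, add_zero, add_zero, add_zero] at h2
    exact (Metric.infDist_le_dist_of_mem (Set.mem_range_self w)).trans
      (ge_of_tendsto h2 (Filter.Eventually.of_forall h1))
  exact ⟨_, r₀, hCP, hCr, fun C' hC' hr' => hmid _ hCP _ hC' hCr hr'⟩

variable {Γ : Type u} [Group Γ] [MulAction Γ X] [IsIsometricSMul Γ X]

theorem smul_mem_parallelFlats {E F : Set X} (hE : E.Nonempty) {g : Γ}
    (hg : AtFiniteDistance (g • E) E) (hF : F ∈ parallelFlats E) : g • F ∈ parallelFlats E :=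
  ⟨hF.1.smul g, (hF.2.smul g).trans (hE.smul_set) hg⟩

/-- Among the flats parallel to `E` there is one invariant under all isometries which map `E` to a
parallel flat. -/
theorem IsCAT0.exists_invariant_flat (hX : IsCAT0 X) [ProperSpace X] {E : Set X} (hE : IsFlat E)
    {B : ℝ} (hB : ParallelFlatsWithin E E B) :
    ∃ C ∈ parallelFlats E, ∀ g : Γ, AtFiniteDistance (g • E) E → g • C = C := by
  obtain ⟨C, r, hC, hr, huniq⟩ := hX.exists_centre_flat hE hB
  -- Such a `g` permutes the parallel flats, so `g • C` is also a circumcentre.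
  refine ⟨C, hC, fun g hg => ((huniq _ (smul_mem_parallelFlats hE.nonempty hg hC) ?_)).symm⟩
  intro G hG x hx
  have hg' : AtFiniteDistance (g⁻¹ • E) E := by
    have := (hg.smul g⁻¹).symm
    rwa [inv_smul_smul] at this
  rw [infDist_smul_set_eq]
  exact hr _ (smul_mem_parallelFlats hE.nonempty hg' hG) _ (Set.smul_mem_smul_set hx)

end Centre

/-! ### Isolated flats and malnormal stabilisers. -/

section Isolated

variable {X : Type v} [MetricSpace X]

/-- A family of flats witnessing that flats are isolated. -/
structure IsIsolatedFamily (𝓕 : Set (Set X)) (B : ℝ) : Prop where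
  isFlat : ∀ E ∈ 𝓕, IsFlat E
  exists_near : ∀ E, IsFlat E → ∃ E' ∈ 𝓕, ∀ x ∈ E, Metric.infDist x E' ≤ B
  eq_of_unbounded : ∀ E₁ ∈ 𝓕, ∀ E₂ ∈ 𝓕, ∀ (k : ℝ) (S : Set X), ¬ Bornology.IsBounded S →
    (∀ x ∈ S, Metric.infDist x E₁ ≤ k) → (∀ x ∈ S, Metric.infDist x E₂ ≤ k) → E₁ = E₂

theorem mem_cthickening_iff_infDist_le {E : Set X} (hE : E.Nonempty) {r : ℝ} (hr : 0 ≤ r) {x : X} :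
    x ∈ Metric.cthickening r E ↔ Metric.infDist x E ≤ r := by
  rw [Metric.mem_cthickening_iff, ENNReal.le_ofReal_iff_toReal_le (Metric.infEDist_ne_top hE) hr,
    Metric.infDist]

theorem HasIsolatedFlats.exists_isIsolatedFamily (h : HasIsolatedFlats X) :
    ∃ (𝓕 : Set (Set X)) (B : ℝ), IsIsolatedFamily 𝓕 B := by
  obtain ⟨𝓕, hflat, ⟨B, hB, hnear⟩, φ, hφ⟩ := h
  refine ⟨𝓕, B, hflat, fun E hE => ?_, fun E₁ h₁ E₂ h₂ k S hS hS₁ hS₂ => ?_⟩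
  · obtain ⟨E', hE', hsub⟩ := hnear E hE
    exact ⟨E', hE', fun x hx => (mem_cthickening_iff_infDist_le (hflat E' hE').nonempty hB).1
      (hsub hx)⟩
  · by_contra hne
    have h3 := hφ E₁ h₁ E₂ h₂ hne k.toNNReal
    have hk : (0 : ℝ) ≤ (k.toNNReal : ℝ) := k.toNNReal.2
    have hsub : S ⊆ Metric.cthickening (k.toNNReal : ℝ) E₁ ∩
        Metric.cthickening (k.toNNReal : ℝ) E₂ := fun x hx =>
      ⟨(mem_cthickening_iff_infDist_le (hflat E₁ h₁).nonempty hk).2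
        ((hS₁ x hx).trans (Real.le_coe_toNNReal k)),
      (mem_cthickening_iff_infDist_le (hflat E₂ h₂).nonempty hk).2
        ((hS₂ x hx).trans (Real.le_coe_toNNReal k))⟩
    refine hS (Metric.isBounded_iff_ediam_ne_top.2 ?_)
    exact ((Metric.ediam_mono hsub).trans_lt (h3.trans ENNReal.coe_lt_top)).ne

namespace IsIsolatedFamily

variable {𝓕 : Set (Set X)} {B : ℝ}

/-- An unbounded part of a flat close to a member of the family determines that member. -/
theorem infDist_le_of_unbounded (h : IsIsolatedFamily 𝓕 B) {E F : Set X} (hE : E ∈ 𝓕)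
    (hF : IsFlat F) {k : ℝ} {S : Set X} (hS : ¬ Bornology.IsBounded S)
    (h₁ : ∀ x ∈ S, Metric.infDist x E ≤ k) (h₂ : ∀ x ∈ S, Metric.infDist x F ≤ k) :
    ∀ x ∈ F, Metric.infDist x E ≤ B := by
  obtain ⟨E', hE', hnear⟩ := h.exists_near F hF
  have : E = E' := by
    refine h.eq_of_unbounded E hE E' hE' (k + max B 0) S hS (fun x hx => ?_) fun x hx => ?_
    · linarith [h₁ x hx, le_max_right B 0]
    · linarith [h₂ x hx, le_max_left B 0, infDist_le_infDist_add hF.nonempty hnear x]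
  rwa [this]

theorem parallelFlatsWithin (h : IsIsolatedFamily 𝓕 B) {E : Set X} (hE : E ∈ 𝓕) :
    ParallelFlatsWithin E E B := by
  intro F hF
  obtain ⟨r, h1, h2⟩ := hF.2
  refine h.infDist_le_of_unbounded hE hF.1 hF.1.not_isBounded (k := max r 0)
    (fun x hx => (h1 x hx).trans (le_max_left _ _)) fun x hx => ?_
  rw [Metric.infDist_zero_of_mem hx]; exact le_max_right _ _

/-- A larger flat shares an unbounded part with `F`, so isolation keeps it near `E`; it is then
parallel to `F` and cannot be larger. -/
theorem isMaximalFlat (h : IsIsolatedFamily 𝓕 B) (hX : IsCAT0 X) [ProperSpace X] {E F : Set X}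
    (hE : E ∈ 𝓕) (hF : F ∈ parallelFlats E) : IsMaximalFlat F := by
  refine ⟨hF.1, fun F' hF' hsub => ?_⟩
  obtain ⟨r, h1, h2⟩ := hF.2
  have h3 := h.infDist_le_of_unbounded hE hF' hF.1.not_isBounded (k := max r 0)
    (fun x hx => (h1 x hx).trans (le_max_left _ _)) fun x hx => by
      rw [Metric.infDist_zero_of_mem (hsub hx)]; exact le_max_right _ _
  have h4 : AtFiniteDistance F F' := by
    refine ⟨max (B + r) 0, fun x hx => ?_, fun x hx => ?_⟩
    · rw [Metric.infDist_zero_of_mem (hsub hx)]; exact le_max_right _ _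
    · refine le_trans ?_ (le_max_left _ _)
      linarith [infDist_le_infDist_add (h.isFlat E hE).nonempty h2 x, h3 x hx]
  exact (hX.eq_of_isFlat_of_subset hF.1 hF' h4 hsub).ge

variable {Γ : Type u} [Group Γ] [MulAction Γ X] [IsIsometricSMul Γ X]

theorem atFiniteDistance_smul (h : IsIsolatedFamily 𝓕 B) {E : Set X} (hE : E ∈ 𝓕) {g : Γ} {k : ℝ}
    {S : Set X} (hS : ¬ Bornology.IsBounded S) (h₁ : ∀ x ∈ S, Metric.infDist x E ≤ k)
    (h₂ : ∀ x ∈ S, Metric.infDist x (g • E) ≤ k) : AtFiniteDistance (g • E) E := by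
  have hflat := h.isFlat E hE
  refine ⟨B, h.infDist_le_of_unbounded hE (hflat.smul g) hS h₁ h₂, fun x hx => ?_⟩
  rw [infDist_smul_set_eq]
  -- The reverse bound is the same argument for `g⁻¹`.
  refine h.infDist_le_of_unbounded hE (hflat.smul g⁻¹) (S := g⁻¹ • S) (k := k) ?_ ?_ ?_ _
    (Set.smul_mem_smul_set hx)
  · intro hb
    apply hS
    have := (isometry_smul X g).lipschitz.isBounded_image hb
    rwa [Set.image_smul, smul_inv_smul] at this
  · rintro _ ⟨x, hx, rfl⟩
    change Metric.infDist (g⁻¹ • x) E ≤ k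
    rw [← infDist_smul_set_eq]
    exact h₂ x hx
  · rintro _ ⟨x, hx, rfl⟩
    exact (infDist_smul_set g⁻¹ x E).trans_le (h₁ x hx)

end IsIsolatedFamily

theorem not_isBounded_range_pow_smul {Γ : Type u} [Group Γ] [MulAction Γ X] [ProperSpace X]
    (hp : IsProperAction Γ X) {b : Γ} (hb : ¬ IsOfFinOrder b) (x : X) :
    ¬ Bornology.IsBounded (Set.range fun n : ℕ => b ^ n • x) := by
  intro hbd
  obtain ⟨R, hR⟩ := hbd.subset_closedBall x
  refine Set.infinite_range_of_injective (injective_pow_iff_not_isOfFinOrder.2 hb)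
    ((hp.finite_dist_le x x R).subset ?_)
  rintro _ ⟨n, rfl⟩
  exact hR ⟨n, rfl⟩

variable {Γ : Type u} [Group Γ] [MulAction Γ X] [IsIsometricSMul Γ X]

/-- An isometry stabilising a flat belongs to an abelian malnormal subgroup. -/
theorem exists_malnormal_of_smul_isFlat_eq (htf : IsTorsionFreeGroup Γ) (hX : IsCAT0 X)
    [ProperSpace X] (hI : HasIsolatedFlats X) (hp : IsProperAction Γ X) (ht : IsToralAction Γ X)
    {a : Γ} {F : Set X} (hF : IsFlat F) (haF : a • F = F) :
    ∃ P : Subgroup Γ, a ∈ P ∧ (∀ x ∈ P, ∀ y ∈ P, x * y = y * x) ∧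
      ∀ b ∈ P, b ≠ 1 → ∀ g : Γ, g * b * g⁻¹ ∈ P → g ∈ P := by
  obtain ⟨𝓕, B, h⟩ := hI.exists_isIsolatedFamily
  obtain ⟨E, hE, hFE⟩ := h.exists_near F hF
  obtain ⟨C, hC, hinv⟩ := hX.exists_invariant_flat (Γ := Γ) (h.isFlat E hE)
    (h.parallelFlatsWithin hE)
  refine ⟨MulAction.stabilizer Γ C, ?_, fun x hx y hy => ?_, fun b hb hb1 g hg => ?_⟩
  · refine hinv a (h.atFiniteDistance_smul hE hF.not_isBounded hFE fun x hx => ?_)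
    rw [infDist_smul_set_eq]
    refine hFE _ ?_
    rw [← haF] at hx
    exact Set.mem_smul_set_iff_inv_smul_mem.1 hx
  · obtain ⟨ι, ⟨e⟩⟩ := ht C (h.isMaximalFlat hX hE hC)
    have : (⟨x, hx⟩ * ⟨y, hy⟩ : MulAction.stabilizer Γ C) = ⟨y, hy⟩ * ⟨x, hx⟩ :=
      e.injective (by rw [map_mul, map_mul, mul_comm])
    exact congrArg Subtype.val this
  · refine hinv g ?_
    obtain ⟨r, hr, -⟩ := hC.2
    obtain ⟨x, hx⟩ := hC.1.nonempty
    set b' := g * b * g⁻¹ with hb'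
    have hb'1 : b' ≠ 1 := by rw [hb', Ne, conj_eq_one_iff]; exact hb1
    have hpow : ∀ n : ℕ, b' ^ n • C = C := fun n =>
      MulAction.mem_stabilizer_iff.1 (pow_mem hg n)
    have hpow' : ∀ n : ℕ, b' ^ n • g • C = g • C := fun n => by
      have e : b' ^ n * g = g * b ^ n := by rw [hb', conj_pow, inv_mul_cancel_right]
      rw [smul_smul, e, mul_smul, MulAction.mem_stabilizer_iff.1 (pow_mem hb n)]
    have hgC : ∀ y ∈ g • C, Metric.infDist y (g • E) ≤ r := by
      rintro _ ⟨y, hy, rfl⟩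
      exact (infDist_smul_set g y E).trans_le (hr y hy)
    -- The orbit of `x` under `b'` stays in `C`, at bounded distance from an orbit in `g • C`.
    refine h.atFiniteDistance_smul hE (not_isBounded_range_pow_smul hp (htf b' hb'1) x)
      (k := dist x (g • x) + r) ?_ ?_
    · rintro _ ⟨n, rfl⟩
      have := hr (b' ^ n • x) (by rw [← hpow n]; exact Set.smul_mem_smul_set hx)
      linarith [dist_nonneg (x := x) (y := g • x)]
    · rintro _ ⟨n, rfl⟩
      have h1 : b' ^ n • g • x ∈ g • C := by
        rw [← hpow' n]; exact Set.smul_mem_smul_set (Set.smul_mem_smul_set hx)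
      have h2 := Metric.infDist_le_dist_add (g • E) (b' ^ n • x) (b' ^ n • g • x)
      rw [dist_smul] at h2
      linarith [hgC _ h1]

end Isolated

/-! ### From centralisers to CSA. -/

section GroupTheory

open scoped commutatorElement

variable {Γ : Type u} [Group Γ]

/-- In a torsion-free group, a centraliser `C(a)` in which `⟨a⟩` has finite index is abelian. -/
theorem IsTorsionFreeGroup.commute_of_finite (htf : IsTorsionFreeGroup Γ) {a : Γ} {S : Set Γ}
    (hS : S.Finite) (h : ∀ c, Commute a c → ∃ k : ℤ, c * a ^ k ∈ S) {c d : Γ}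
    (hc : Commute a c) (hd : Commute a d) : Commute c d := by
  -- Since `a` is central in its centraliser, a commutator depends only on cosets of `⟨a⟩`, so there
  -- are finitely many.
  have hcomm : ∀ c d : Γ, Commute a c → Commute a d → ∀ k l : ℤ,
      ⁅c * a ^ k, d * a ^ l⁆ = ⁅c, d⁆ := by
    intro c d hc hd k l
    have h1 : Commute (a ^ k) d := hd.zpow_left k
    have h2 : Commute (a ^ l) c := hc.zpow_left l
    have h3 : Commute (a ^ k) (a ^ l) := Commute.zpow_zpow_self a k l
    calc ⁅c * a ^ k, d * a ^ l⁆
        = c * (a ^ k * (d * a ^ l)) * (a ^ k)⁻¹ * c⁻¹ * ((a ^ l)⁻¹ * d⁻¹) := by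
          rw [commutatorElement_def]; group
      _ = c * d * (a ^ l * c⁻¹) * (a ^ l)⁻¹ * d⁻¹ := by
          rw [(h1.mul_right h3).eq]; group
      _ = ⁅c, d⁆ := by rw [h2.inv_right.eq, commutatorElement_def]; group
  let H := Subgroup.centralizer {a}
  have hH : ∀ c : Γ, c ∈ H ↔ Commute a c := fun c => by
    rw [Subgroup.mem_centralizer_singleton_iff, commute_iff_eq, eq_comm]
  have hfin : (commutatorSet H).Finite := by
    refine Set.Finite.of_finite_image ?_ (Subtype.val_injective.injOn)
    refine ((hS.prod hS).image fun p : Γ × Γ => ⁅p.1, p.2⁆).subset ?_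
    rintro _ ⟨_, ⟨c, d, rfl⟩, rfl⟩
    have hc := (hH c).1 c.2
    have hd := (hH d).1 d.2
    obtain ⟨k, hk⟩ := h c hc
    obtain ⟨l, hl⟩ := h d hd
    exact ⟨(c * a ^ k, d * a ^ l), ⟨hk, hl⟩, hcomm c d hc hd k l⟩
  have : Finite (commutatorSet H) := hfin.to_subtype
  let c' : H := ⟨c, (hH c).2 hc⟩
  let d' : H := ⟨d, (hH d).2 hd⟩
  have hmem : ⁅c', d'⁆ ∈ commutator H :=
    Subgroup.commutator_mem_commutator (Subgroup.mem_top _) (Subgroup.mem_top _)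
  have hord : IsOfFinOrder (⁅c', d'⁆ : H) := by
    -- Schur's theorem: a group with finitely many commutators has a finite commutator subgroup.
    have := isOfFinOrder_of_finite (⟨⁅c', d'⁆, hmem⟩ : commutator H)
    exact (commutator H).subtype.isOfFinOrder this
  have hord' : IsOfFinOrder ⁅c, d⁆ := H.subtype.isOfFinOrder hord
  have : ⁅c, d⁆ = 1 := by
    by_contra hne
    exact htf _ hne hord'
  exact commutatorElement_eq_one_iff_commute.1 this

/-- Two commuting elements are commensurable if finitely many cosets of `⟨a⟩` cover `C(a)`. -/
theorem exists_pow_eq_zpow_of_finite {a b : Γ} {S : Set Γ} (hS : S.Finite)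
    (h : ∀ c, Commute a c → ∃ k : ℤ, c * a ^ k ∈ S) (hb : Commute a b) :
    ∃ n : ℤ, n ≠ 0 ∧ ∃ m : ℤ, b ^ n = a ^ m := by
  choose k hk using fun n : ℕ => h (b ^ n) (hb.pow_right n)
  -- Pigeonhole: two powers of `b` have the same representative in `S`.
  obtain ⟨i, -, j, -, hij, he⟩ := Set.infinite_univ.exists_ne_map_eq_of_mapsTo
    (f := fun n : ℕ => b ^ n * a ^ k n) (fun n _ => hk n) hS
  refine ⟨(i : ℤ) - j, sub_ne_zero.2 (by exact_mod_cast hij), k j - k i, ?_⟩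
  have he' : b ^ i * a ^ k i = b ^ j * a ^ k j := he
  rw [zpow_sub, zpow_sub, zpow_natCast, zpow_natCast]
  have h1 : b ^ i = b ^ j * (a ^ k j * (a ^ k i)⁻¹) := by
    rw [← mul_assoc, ← he', mul_inv_cancel_right]
  have h2 : Commute (b ^ j) (a ^ k j * (a ^ k i)⁻¹) :=
    ((hb.symm.pow_left j).zpow_right _).mul_right ((hb.symm.pow_left j).zpow_right _).inv_right
  rw [h1, h2.eq, mul_inv_cancel_right]

/-- A torsion-free group is CSA if each nontrivial element either belongs to an abelian malnormal
subgroup or generates a subgroup of finite index in its centraliser, and if conjugate powers of an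
element have the same exponent up to sign. -/
theorem IsTorsionFreeGroup.isCSA (htf : IsTorsionFreeGroup Γ)
    (h₁ : ∀ a : Γ, a ≠ 1 → (∃ P : Subgroup Γ, a ∈ P ∧ (∀ x ∈ P, ∀ y ∈ P, x * y = y * x) ∧
        ∀ b ∈ P, b ≠ 1 → ∀ g : Γ, g * b * g⁻¹ ∈ P → g ∈ P) ∨
      ∃ S : Set Γ, S.Finite ∧ ∀ c, Commute a c → ∃ k : ℤ, c * a ^ k ∈ S)
    (h₂ : ∀ a : Γ, a ≠ 1 → ∀ (g : Γ) (m n : ℤ), g * a ^ n * g⁻¹ = a ^ m → |m| = |n|) :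
    IsCSA Γ := by
  have htrans : ∀ a : Γ, a ≠ 1 → ∀ c d : Γ, Commute a c → Commute a d → Commute c d := by
    intro a ha c d hc hd
    rcases h₁ a ha with ⟨P, haP, hP, hm⟩ | ⟨S, hS, hSa⟩
    · have key : ∀ c, Commute a c → c ∈ P := fun c hc =>
        hm a haP ha c (by rw [← hc.eq, mul_inv_cancel_right]; exact haP)
      exact hP c (key c hc) d (key d hd)
    · exact htf.commute_of_finite hS hSa hc hd
  intro A hA
  have hAc : ∀ x ∈ A, ∀ y ∈ A, Commute x y := hA.1
  have hmax : ∀ a ∈ A, a ≠ 1 → ∀ c, Commute a c → c ∈ A := by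
    intro a haA ha c hc
    have hle : A ≤ Subgroup.centralizer {a} := fun x hx =>
      Subgroup.mem_centralizer_singleton_iff.2 (hAc x hx a haA)
    have hab : ∀ x ∈ Subgroup.centralizer {a}, ∀ y ∈ Subgroup.centralizer {a},
        x * y = y * x := fun x hx y hy =>
      htrans a ha x y (Subgroup.mem_centralizer_singleton_iff.1 hx).symm
        (Subgroup.mem_centralizer_singleton_iff.1 hy).symm
    exact hA.2 hab hle (Subgroup.mem_centralizer_singleton_iff.2 hc.symm.eq)
  intro g hg
  rw [Subgroup.eq_bot_iff_forall]
  rintro b ⟨⟨a, haA, hab⟩, hbA⟩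
  have hab' : g * a * g⁻¹ = b := hab
  by_contra hb
  have ha : a ≠ 1 := by
    rintro rfl
    apply hb
    rw [← hab', mul_one, mul_inv_cancel]
  apply hg
  rcases h₁ a ha with ⟨P, haP, hP, hm⟩ | ⟨S, hS, hSa⟩
  · have hbP : b ∈ P := hm a haP ha b (by
      rw [(hAc b hbA a haA).eq, mul_inv_cancel_right]; exact haP)
    have hgP : g ∈ P := hm a haP ha g (hab' ▸ hbP)
    exact hmax a haA ha g (hP a haP g hgP)
  · obtain ⟨n, hn, m, hnm⟩ := exists_pow_eq_zpow_of_finite hS hSa (hAc a haA b hbA)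
    have hconj : g * a ^ n * g⁻¹ = a ^ m := by rw [← hnm, ← hab', conj_zpow]
    have han : a ^ n ≠ 1 := fun h =>
      htf a ha (isOfFinOrder_iff_zpow_eq_one.2 ⟨n, hn, h⟩)
    have hanA : a ^ n ∈ A := zpow_mem haA n
    rcases abs_eq_abs.1 (h₂ a ha g m n hconj) with rfl | rfl
    · exact hmax _ hanA han g (mul_inv_eq_iff_eq_mul.1 hconj).symm
    -- Here `g` inverts `a ^ n`, so `g ^ 2` centralises it and lies in `A`; it is nontrivial and
    -- commutes with `g`.
    · rw [zpow_neg] at hconj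
      have h1 : g * (a ^ n)⁻¹ * g⁻¹ = a ^ n := by
        rw [← conj_inv, hconj, inv_inv]
      have h2 : g ^ 2 * a ^ n * (g ^ 2)⁻¹ = a ^ n := by
        calc g ^ 2 * a ^ n * (g ^ 2)⁻¹ = g * (g * a ^ n * g⁻¹) * g⁻¹ := by
              rw [pow_two]; group
          _ = a ^ n := by rw [hconj, h1]
      have hg2 : g ^ 2 ∈ A := hmax _ hanA han _ (mul_inv_eq_iff_eq_mul.1 h2).symm
      have hg1 : g ≠ 1 := fun h => hg (h ▸ one_mem A)
      have hg21 : g ^ 2 ≠ 1 := fun h =>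
        htf g hg1 (isOfFinOrder_iff_pow_eq_one.2 ⟨2, two_pos, h⟩)
      exact hmax _ hg2 hg21 g (Commute.pow_self g 2)

end GroupTheory

/-! ### Conjugate powers and displacement; conclusion. -/

section Action

variable {Γ : Type u} [Group Γ] {X : Type v} [MetricSpace X] [MulAction Γ X] [IsIsometricSMul Γ X]

theorem IsProperAction.dist_smul_pos {Γ : Type u} [Group Γ] {X : Type v} [MetricSpace X]
    [MulAction Γ X] [ProperSpace X] (hp : IsProperAction Γ X) {a : Γ}
    (ha : ¬ IsOfFinOrder a) (x : X) : 0 < dist (a • x) x := by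
  refine dist_pos.2 fun hax => not_isBounded_range_pow_smul hp ha x ?_
  refine Bornology.IsBounded.subset (Bornology.isBounded_singleton (x := x)) ?_
  rintro _ ⟨n, rfl⟩
  exact MulAction.mem_stabilizer_iff.1 (pow_mem (MulAction.mem_stabilizer_iff.2 hax) n)

/-- Powers of a hyperbolic isometry can be conjugate only if the exponents agree up to sign. -/
theorem IsCAT0.abs_eq_abs_of_conj_zpow (hX : IsCAT0 X) {a : Γ} {x : X}
    (h : ∀ y : X, dist (a • x) x ≤ dist (a • y) y) (hpos : 0 < dist (a • x) x) {g : Γ} {m n : ℤ}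
    (hg : g * a ^ n * g⁻¹ = a ^ m) : |m| = |n| := by
  have key : ∀ (g : Γ) (m n : ℤ), g * a ^ n * g⁻¹ = a ^ m → |m| ≤ |n| := by
    intro g m n hg
    set τ := dist (a • x) x
    by_contra hlt
    have hlt' : |(n : ℝ)| + 1 ≤ |(m : ℝ)| := by exact_mod_cast (not_le.1 hlt)
    -- The displacements of `x` and `g • x` under `a ^ (m * k)` differ by at most `2 * dist (g • x)
    -- x`, but if `|n| < |m|` they differ by at least `k * τ`.
    obtain ⟨k, hk⟩ := exists_nat_gt (2 * dist (g • x) x / τ)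
    have e : a ^ (m * k) * g = g * a ^ (n * k) := by
      rw [zpow_mul, zpow_mul, ← hg, conj_zpow, inv_mul_cancel_right]
    have h1 : dist (a ^ (m * k) • g • x) (g • x) = |(n : ℝ)| * k * τ := by
      rw [smul_smul, e, mul_smul, dist_smul, hX.dist_zpow_smul h]
      push_cast
      rw [abs_mul, Nat.abs_cast]
    have h2 : dist (a ^ (m * k) • x) x = |(m : ℝ)| * k * τ := by
      rw [hX.dist_zpow_smul h]
      push_cast
      rw [abs_mul, Nat.abs_cast]
    have h3 := dist_triangle4 (a ^ (m * k) • x) (a ^ (m * k) • g • x) (g • x) x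
    rw [dist_smul, h1, h2, dist_comm x] at h3
    rw [div_lt_iff₀ hpos] at hk
    have h4 : 0 ≤ (k : ℝ) * τ := by positivity
    have h5 := mul_le_mul_of_nonneg_right hlt' h4
    linarith
  refine le_antisymm (key g m n hg) (key g⁻¹ n m ?_)
  rw [← hg]; group

end Action

theorem corollary2p9 (Γ : Type u) [Group Γ] (htf : IsTorsionFreeGroup Γ)
    (htoral : IsToralCAT0GroupWithIsolatedFlats.{u, v} Γ) : IsCSA Γ := by
  obtain ⟨X, _, _, _, hX, hI, _, hp, hc, ht⟩ := htoral
  have : ProperSpace X := hp.properSpace hX hc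
  refine htf.isCSA (fun a ha => ?_) fun a ha g m n hg => ?_
  · obtain ⟨x, hx⟩ := hp.exists_minimal_displacement hc a
    refine (hp.exists_isFlat_or_finite hc hX hx (hp.dist_smul_pos (htf a ha) x)).imp_left ?_
    rintro ⟨F, hF, haF⟩
    exact exists_malnormal_of_smul_isFlat_eq htf hX hI hp ht hF haF
  · obtain ⟨x, hx⟩ := hp.exists_minimal_displacement hc a
    exact hX.abs_eq_abs_of_conj_zpow hx (hp.dist_smul_pos (htf a ha) x) hg
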